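/- **Setting and notation.** Let $G$ be a connected (finite-dimensional, real, smooth) Lie group with identity $e$ and $\mathfrak g=T_eG$, endowed with a smooth left-invariant Riemannian metric $\langle\cdot,\cdot\rangle$; write $g^{-1}v:=d(L_{g^{-1}})_g v\in\mathfrak g$ for $v\in T_gG$. Let $\nabla$ be the Levi-Civita connection, $R(X,Y)Z=\nabla_X\nabla_YZ-\nabla_Y\nabla_XZ-\nabla_{[X,Y]}Z$ its curvature, and $D_t$ the covariant derivative along a curve; for a $(1,3)$-tensor $T$ along a curve, $(D_tT)(X,Y)Z=D_t(T(X,Y)Z)-T(D_tX,Y)Z-T(X,D_tY)Z-T(X,Y)D_tZ$. For $\xi,\eta\in\mathfrak g$ let $\nabla^{\mathfrak g}_\xi\eta:=(\nabla_{\phi(\xi)}\phi(\eta))(e)$, where $\phi(\xi)$ is the left-invariant vector field with value $\xi$ at $e$. Let $V:G\to\mathbb R$ be smooth, $g_0\in G$, and let $V_{\rm ext}:G\times G\to\mathbb R$ satisfy $V_{\rm ext}(q,g_0)=V(q)$ and $V_{\rm ext}(kp,kq)=V_{\rm ext}(p,q)$ for all $k,p,q\in G$. Let $a<b$ and let $g:[a,b]\to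 G$ be a *modified Riemannian cubic*, i.e. a smooth curve with $D_t^3\dot g+R(D_t\dot g,\dot g)\dot g=-\operatorname{grad}V(g)$ on $[a,b]$. A *(modified) bi-Jacobi field* along $g$ is a smooth vector field $X$ along $g$ with $$D_t^4X+F(X,\dot g)+\nabla_X\operatorname{grad}V(g)=0\quad\text{on }[a,b],$$ where $$\begin{aligned}F(X,\dot g)={}&(D_t^2R)(X,\dot g)\dot g+(\nabla_XR)(D_t\dot g,\dot g)\dot g+R(R(X,\dot g)\dot g,\dot g)\dot g+R(X,D_t^2\dot g)\dot g+4R(D_tX,\dot g)D_t\dot g\\&+2\big[(D_tR)(D_tX,\dot g)\dot g+(D_tR)(X,D_t\dot g)\dot g+R(D_t^2X,\dot g)\dot g\big]\\&+3\big[(D_tR)(X,\dot g)D_t\dot g+R(X,\dot g)D_t^2\dot g+R(X,D_t\dot g)D_t\dot g\big].\end{aligned}$$ Put $h:=g^{-1}g_0$, $\xi^{(0)}:=g^{-1}\dot g$, and $\xi^{(i+1)}:=\dot\xi^{(i)}+\nabla^{\mathfrak g}_{\xi^{(0)}}\xi^{(i)}$ for $i=0,1$ (only $\xi^{(0)},\xi^{(1)},\xi^{(2)}$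 occur below). Write $R$ also for the curvature $R_e:\mathfrak g^3\to\mathfrak g$ at $e$. For $w\in\mathfrak g$ and $T:\mathfrak g^3\to\mathfrak g$, put $$(\nabla^{\mathfrak g}_wT)(x,y)z:=\nabla^{\mathfrak g}_w(T(x,y)z)-T(\nabla^{\mathfrak g}_wx,y)z-T(x,\nabla^{\mathfrak g}_wy)z-T(x,y)\nabla^{\mathfrak g}_wz ,$$ and define $\mathcal F:\mathfrak g^6\to\mathfrak g$ by $$\begin{aligned}\mathcal F(x_0,x_1,x_2,y_0,y_1,y_2)={}&\big(\nabla^{\mathfrak g}_{y_1-\nabla^{\mathfrak g}_{y_0}y_0}R+\nabla^{\mathfrak g}_{y_0}\nabla^{\mathfrak g}_{y_0}R\big)(x_0,y_0)y_0+(\nabla^{\mathfrak g}_{x_0}R)(y_1,y_0)y_0+R(R(x_0,y_0)y_0,y_0)y_0\\&+R(x_0,y_2)y_0+4R(x_1,y_0)y_1+2\big[(\nabla^{\mathfrak g}_{y_0}R)(x_1,y_0)y_0+(\nabla^{\mathfrak g}_{y_0}R)(x_0,y_1)y_0+R(x_2,y_0)y_0\big]\\&+3\big[(\nabla^{\mathfrak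 g}_{y_0}R)(x_0,y_0)y_1+R(x_0,y_0)y_2+R(x_0,y_1)y_1\big].\end{aligned}$$ For $x\in\mathfrak g$ and $p\in G$ let $D_x\operatorname{grad}_1V_{\rm ext}(e,p)\in\mathfrak g$ be the derivative at $q=e$, in the direction $x$, of the $\mathfrak g$-valued function $q\mapsto q^{-1}\operatorname{grad}_1V_{\rm ext}(q,p)$ (that is, differentiate the components of $\operatorname{grad}_1V_{\rm ext}(\cdot,p)$ in a left-invariant frame). **Theorem.** (i) $\nabla^{\mathfrak g}$ is bilinear and $R$ is trilinear on $\mathfrak g$, so that each term of $\mathcal F$ is multilinear in its entries; $\mathcal F$ is smooth, and linear in $(x_0,x_1,x_2)$. For every smooth vector field $X$ along $g$, with $\mathcal X^{(0)}:=g^{-1}X$ and $\mathcal X^{(i+1)}:=\dot{\mathcal X}^{(i)}+\nabla^{\mathfrak g}_{\xi^{(0)}}\mathcal X^{(i)}$, one has $$g^{-1}F(X,\dot g)=\mathcal F(\mathcal X^{(0)},\mathcal X^{(1)},\mathcal X^{(2)},\xi^{(0)},\xi^{(1)},\xi^{(2)})\quad\text{on }[a,b].$$ (ii) A vector field $X$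 along $g$ is a (modified) bi-Jacobi field along $g$ if and only if $\mathcal X^{(0)}:=g^{-1}X:[a,b]\to\mathfrak g$ is smooth and there are $\mathcal X^{(1)},\mathcal X^{(2)},\mathcal X^{(3)}:[a,b]\to\mathfrak g$ such that on $[a,b]$ $$\mathcal X^{(i+1)}=\dot{\mathcal X}^{(i)}+\nabla^{\mathfrak g}_{\xi^{(0)}}\mathcal X^{(i)}\qquad(i=0,1,2),$$ $$0=\dot{\mathcal X}^{(3)}+\nabla^{\mathfrak g}_{\xi^{(0)}}\mathcal X^{(3)}+\big(D_{\mathcal X^{(0)}}+\nabla^{\mathfrak g}_{\mathcal X^{(0)}}\big)\operatorname{grad}_1V_{\rm ext}(e,h)+\mathcal F(\mathcal X^{(0)},\mathcal X^{(1)},\mathcal X^{(2)},\xi^{(0)},\xi^{(1)},\xi^{(2)}).$$ -/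

import Mathlib

open Bundle Manifold Set
open scoped ContDiff

noncomputable section
namespace RiemCubic

section LeviCivita
variable {E : Type*} [NormedAddCommGroup E] [NormedSpace ℝ E] [FiniteDimensional ℝ E]
  {H : Type*} [TopologicalSpace H] (I : ModelWithCorners ℝ E H)
  {M : Type*} [TopologicalSpace M] [ChartedSpace H M] [IsManifold I ∞ M]
  [RiemannianBundle (fun x : M ↦ TangentSpace I x)]
  [IsContMDiffRiemannianBundle I ∞ E (fun x : M ↦ TangentSpace I x)]

instance instFiniteDimensionalTangentSpace (x : M) : FiniteDimensional ℝ (TangentSpace I x) := inferInstanceAs (FiniteDimensional ℝ E)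

/-- The Koszul expression
`½ (X⟨Y,Z⟩ + Y⟨X,Z⟩ - Z⟨X,Y⟩ + ⟨[X,Y],Z⟩ - ⟨[X,Z],Y⟩ - ⟨[Y,Z],X⟩)`. -/
def koszul (X Y Z : Π x : M, TangentSpace I x) (x : M) : ℝ :=
  (1 / 2 : ℝ) *
    (mvfderiv I (fun y ↦ inner ℝ (Y y) (Z y)) x (X x)
      + mvfderiv I (fun y ↦ inner ℝ (X y) (Z y)) x (Y x)
      - mvfderiv I (fun y ↦ inner ℝ (X y) (Y y)) x (Z x)
      + inner ℝ (VectorField.mlieBracket I X Y x) (Z x)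
      - inner ℝ (VectorField.mlieBracket I X Z x) (Y x)
      - inner ℝ (VectorField.mlieBracket I Y Z x) (X x))

/-- The gradient of `f`: `⟨grad f x, w⟩ = df_x w`. -/
def grad (f : M → ℝ) (x : M) : TangentSpace I x :=
  (InnerProductSpace.toDual ℝ (TangentSpace I x)).symm (mvfderiv I f x)

variable {I}
theorem mdifferentiableAt_inner {X Y : Π x : M, TangentSpace I x} {x : M}
    (hX : MDiffAt (T% X) x) (hY : MDiffAt (T% Y) x) :
    MDiffAt (fun y ↦ (inner ℝ (X y) (Y y) : ℝ)) x :=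
  MDifferentiableAt.inner_bundle (F := E) (E := fun x : M ↦ TangentSpace I x) (b := fun y ↦ y)
    (IB := I) hX hY

theorem koszul_tensorial_left {Y Z : Π x : M, TangentSpace I x} {x : M}
    (hY : MDiffAt (T% Y) x) (hZ : MDiffAt (T% Z) x) :
    TensorialAt I E (fun X ↦ koszul I X Y Z x) x where
  smul {f X} hf hX := by
    simp only [koszul]
    have e1 : (fun y ↦ inner ℝ ((f • X) y) (Z y)) = f * fun y ↦ inner ℝ (X y) (Z y) := by
      ext y; simp [inner_smul_left]
    have e2 : (fun y ↦ inner ℝ ((f • X) y) (Y y)) = f * fun y ↦ inner ℝ (X y) (Y y) := by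
      ext y; simp [inner_smul_left]
    rw [e1, e2, mvfderiv_mul hf (mdifferentiableAt_inner hX hZ), mvfderiv_mul hf (mdifferentiableAt_inner hX hY),
      VectorField.mlieBracket_smul_left hf hX, VectorField.mlieBracket_smul_left hf hX]
    simp [inner_add_left, inner_smul_left, inner_smul_right]
    ring
  add {X X'} hX hX' := by
    simp only [koszul]
    have e1 : (fun y ↦ inner ℝ ((X + X') y) (Z y)) =
      (fun y ↦ inner ℝ (X y) (Z y)) + fun y ↦ inner ℝ (X' y) (Z y) := by
      ext y; simp [inner_add_left]
    have e2 : (fun y ↦ inner ℝ ((X + X') y) (Y y)) =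
      (fun y ↦ inner ℝ (X y) (Y y)) + fun y ↦ inner ℝ (X' y) (Y y) := by
      ext y; simp [inner_add_left]
    rw [e1, e2, mvfderiv_add (mdifferentiableAt_inner hX hZ) (mdifferentiableAt_inner hX' hZ),
      mvfderiv_add (mdifferentiableAt_inner hX hY) (mdifferentiableAt_inner hX' hY),
      VectorField.mlieBracket_add_left hX hX', VectorField.mlieBracket_add_left hX hX']
    simp [inner_add_left, inner_add_right]
    ring


theorem koszul_tensorial_right {X Y : Π x : M, TangentSpace I x} {x : M}
    (hX : MDiffAt (T% X) x) (hY : MDiffAt (T% Y) x) :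
    TensorialAt I E (fun Z ↦ koszul I X Y Z x) x where
  smul {f Z} hf hZ := by
    simp only [koszul]
    have e1 : (fun y ↦ inner ℝ (Y y) ((f • Z) y)) = f * fun y ↦ inner ℝ (Y y) (Z y) := by
      ext y; simp [inner_smul_right]
    have e2 : (fun y ↦ inner ℝ (X y) ((f • Z) y)) = f * fun y ↦ inner ℝ (X y) (Z y) := by
      ext y; simp [inner_smul_right]
    rw [e1, e2, mvfderiv_mul hf (mdifferentiableAt_inner hY hZ),
      mvfderiv_mul hf (mdifferentiableAt_inner hX hZ),
      VectorField.mlieBracket_smul_right hf hZ, VectorField.mlieBracket_smul_right hf hZ]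
    simp [inner_add_left, inner_smul_left, inner_smul_right]
    rw [real_inner_comm (X x) (Z x), real_inner_comm (Y x) (Z x)]
    ring
  add {Z Z'} hZ hZ' := by
    simp only [koszul]
    have e1 : (fun y ↦ inner ℝ (Y y) ((Z + Z') y)) =
      (fun y ↦ inner ℝ (Y y) (Z y)) + fun y ↦ inner ℝ (Y y) (Z' y) := by
      ext y; simp [inner_add_right]
    have e2 : (fun y ↦ inner ℝ (X y) ((Z + Z') y)) =
      (fun y ↦ inner ℝ (X y) (Z y)) + fun y ↦ inner ℝ (X y) (Z' y) := by
      ext y; simp [inner_add_right]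
    rw [e1, e2, mvfderiv_add (mdifferentiableAt_inner hY hZ) (mdifferentiableAt_inner hY hZ'),
      mvfderiv_add (mdifferentiableAt_inner hX hZ) (mdifferentiableAt_inner hX hZ'),
      VectorField.mlieBracket_add_right hZ hZ', VectorField.mlieBracket_add_right hZ hZ']
    simp [inner_add_left, inner_add_right]
    ring

theorem koszul_add {X Y Y' Z : Π x : M, TangentSpace I x} {x : M}
    (hX : MDiffAt (T% X) x) (hY : MDiffAt (T% Y) x) (hY' : MDiffAt (T% Y') x)
    (hZ : MDiffAt (T% Z) x) :
    koszul I X (Y + Y') Z x = koszul I X Y Z x + koszul I X Y' Z x := by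
  simp only [koszul]
  have e1 : (fun y ↦ inner ℝ ((Y + Y') y) (Z y)) =
    (fun y ↦ inner ℝ (Y y) (Z y)) + fun y ↦ inner ℝ (Y' y) (Z y) := by
    ext y; simp [inner_add_left]
  have e2 : (fun y ↦ inner ℝ (X y) ((Y + Y') y)) =
    (fun y ↦ inner ℝ (X y) (Y y)) + fun y ↦ inner ℝ (X y) (Y' y) := by
    ext y; simp [inner_add_right]
  rw [e1, e2, mvfderiv_add (mdifferentiableAt_inner hY hZ) (mdifferentiableAt_inner hY' hZ),
    mvfderiv_add (mdifferentiableAt_inner hX hY) (mdifferentiableAt_inner hX hY'),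
    VectorField.mlieBracket_add_right hY hY', VectorField.mlieBracket_add_left hY hY']
  simp [inner_add_left, inner_add_right]
  ring

theorem koszul_smul {f : M → ℝ} {X Y Z : Π x : M, TangentSpace I x} {x : M}
    (hf : MDiffAt f x) (hX : MDiffAt (T% X) x) (hY : MDiffAt (T% Y) x)
    (hZ : MDiffAt (T% Z) x) :
    koszul I X (f • Y) Z x =
      f x * koszul I X Y Z x + mvfderiv I f x (X x) * inner ℝ (Y x) (Z x) := by
  simp only [koszul]
  have e1 : (fun y ↦ inner ℝ ((f • Y) y) (Z y)) = f * fun y ↦ inner ℝ (Y y) (Z y) := by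
    ext y; simp [inner_smul_left]
  have e2 : (fun y ↦ inner ℝ (X y) ((f • Y) y)) = f * fun y ↦ inner ℝ (X y) (Y y) := by
    ext y; simp [inner_smul_right]
  rw [e1, e2, mvfderiv_mul hf (mdifferentiableAt_inner hY hZ),
    mvfderiv_mul hf (mdifferentiableAt_inner hX hY),
    VectorField.mlieBracket_smul_right hf hY, VectorField.mlieBracket_smul_left hf hY]
  simp [inner_add_left, inner_smul_left, inner_smul_right]
  rw [real_inner_comm (X x) (Y x)]
  ring

open FiberBundle

variable (I) in
open Classical in
/-- The vector `∇_u Y` at `x`, characterised by the Koszul formula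
`⟨∇_u Y, w⟩ = koszul U Y W x` for differentiable fields `U`, `W` with `U x = u`, `W x = w`. -/
def leviCivitaAux (Y : Π x : M, TangentSpace I x) (x : M) :
    TangentSpace I x →L[ℝ] TangentSpace I x :=
  if hY : MDiffAt (T% Y) x then
    LinearMap.toContinuousLinearMap
      ((InnerProductSpace.toDual ℝ (TangentSpace I x)).symm.toLinearEquiv.toLinearMap ∘ₗ
      (TensorialAt.mkHom₂ (I := I) (F := E) (F' := E) (A := ℝ)
        (V := fun x : M ↦ TangentSpace I x) (V' := fun x : M ↦ TangentSpace I x)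
        (fun U W ↦ koszul I U Y W x) x
        (fun _ hW ↦ koszul_tensorial_left hY hW)
        (fun _ hU ↦ koszul_tensorial_right hU hY)).toLinearMap)
  else 0

theorem inner_leviCivitaAux {X Y Z : Π x : M, TangentSpace I x} {x : M}
    (hX : MDiffAt (T% X) x) (hY : MDiffAt (T% Y) x) (hZ : MDiffAt (T% Z) x) :
    inner ℝ (leviCivitaAux I Y x (X x)) (Z x) = koszul I X Y Z x := by
  rw [leviCivitaAux, dif_pos hY]
  exact (InnerProductSpace.toDual_symm_apply (𝕜 := ℝ) (E := TangentSpace I x)).trans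
    (TensorialAt.mkHom₂_apply (I := I) (F := E) (F' := E) (A := ℝ)
      (V := fun x : M ↦ TangentSpace I x) (V' := fun x : M ↦ TangentSpace I x)
      (Φ := fun U W ↦ koszul I U Y W x)
      (fun _ hW ↦ koszul_tensorial_left hY hW)
      (fun _ hU ↦ koszul_tensorial_right hU hY) hX hZ)

theorem inner_leviCivitaAux_extend {Y : Π x : M, TangentSpace I x} {x : M}
    (hY : MDiffAt (T% Y) x) (u w : TangentSpace I x) :
    inner ℝ (leviCivitaAux I Y x u) w = koszul I (extend E u) Y (extend E w) x := by
  rw [← inner_leviCivitaAux (mdifferentiableAt_extend ..) hY (mdifferentiableAt_extend ..)]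
  simp

variable (I M) in
/-- The Levi-Civita connection of a Riemannian manifold. -/
def leviCivita : CovariantDerivative I E (fun x : M ↦ TangentSpace I x) where
  toFun := leviCivitaAux I
  isCovariantDerivativeOnUniv :=
    { add := fun {Y Y' x} hY hY' _ ↦ by
        ext u
        refine ext_inner_right ℝ fun w ↦ ?_
        rw [inner_leviCivitaAux_extend (mdifferentiableAt_add_section hY hY'),
          koszul_add (mdifferentiableAt_extend ..) hY hY' (mdifferentiableAt_extend ..),
          _root_.add_apply, inner_add_left,
          inner_leviCivitaAux_extend hY, inner_leviCivitaAux_extend hY']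
      leibniz := fun {Y f x} hY hf _ ↦ by
        ext u
        refine ext_inner_right ℝ fun w ↦ ?_
        rw [inner_leviCivitaAux_extend (hf.smul_section hY),
          koszul_smul hf (mdifferentiableAt_extend ..) hY (mdifferentiableAt_extend ..),
          _root_.add_apply, inner_add_left]
        simp [inner_leviCivitaAux_extend hY, inner_smul_left] }

theorem inner_leviCivita {X Y Z : Π x : M, TangentSpace I x} {x : M}
    (hX : MDiffAt (T% X) x) (hY : MDiffAt (T% Y) x) (hZ : MDiffAt (T% Z) x) :
    inner ℝ (leviCivita I M Y x (X x)) (Z x) = koszul I X Y Z x :=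
  inner_leviCivitaAux hX hY hZ

theorem leviCivita_torsionFree {X Y : Π x : M, TangentSpace I x} {x : M}
    (hX : MDiffAt (T% X) x) (hY : MDiffAt (T% Y) x) :
    leviCivita I M Y x (X x) - leviCivita I M X x (Y x) = VectorField.mlieBracket I X Y x := by
  refine ext_inner_right ℝ fun w ↦ ?_
  obtain ⟨Z, hZ, rfl⟩ : ∃ Z : Π x : M, TangentSpace I x, MDiffAt (T% Z) x ∧ Z x = w :=
    ⟨extend E w, mdifferentiableAt_extend .., by simp⟩
  rw [inner_sub_left, inner_leviCivita hX hY hZ, inner_leviCivita hY hX hZ, koszul, koszul,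
    VectorField.mlieBracket_swap_apply (V := Y) (W := X)]
  simp_rw [real_inner_comm (X _) (Y _)]
  simp
  ring

theorem leviCivita_metric {X Y Z : Π x : M, TangentSpace I x} {x : M}
    (hX : MDiffAt (T% X) x) (hY : MDiffAt (T% Y) x) (hZ : MDiffAt (T% Z) x) :
    mvfderiv I (fun y ↦ inner ℝ (Y y) (Z y)) x (X x) =
      inner ℝ (leviCivita I M Y x (X x)) (Z x) + inner ℝ (Y x) (leviCivita I M Z x (X x)) := by
  rw [real_inner_comm (leviCivita I M Z x (X x)) (Y x), inner_leviCivita hX hY hZ,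
    inner_leviCivita hX hZ hY, koszul, koszul,
    VectorField.mlieBracket_swap_apply (V := Z) (W := Y)]
  simp_rw [real_inner_comm (Y _) (Z _)]
  simp
  ring

theorem leviCivita_torsion : (leviCivita I M).torsion = 0 :=
  (leviCivita I M).torsion_eq_zero_iff.2 leviCivita_torsionFree

theorem leviCivita_isMetricCompatible :
    CovariantDerivative.IsMetricCompatible (V := fun x : M ↦ TangentSpace I x) (leviCivita I M) :=
  (CovariantDerivative.isMetricCompatible_iff _).2 leviCivita_metric

end LeviCivita

section Connection

variable {E : Type*} [NormedAddCommGroup E] [NormedSpace ℝ E]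
  {H : Type*} [TopologicalSpace H] {I : ModelWithCorners ℝ E H}
  {M : Type*} [TopologicalSpace M] [ChartedSpace H M] [IsManifold I ∞ M]
  (cov : CovariantDerivative I E (fun x : M ↦ TangentSpace I x))

/-- The curvature `R(X,Y)Z = ∇_X ∇_Y Z - ∇_Y ∇_X Z - ∇_[X,Y] Z` on vector fields. -/
def curvatureField (X Y Z : Π x : M, TangentSpace I x) (x : M) : TangentSpace I x :=
  cov (fun y ↦ cov Z y (Y y)) x (X x) - cov (fun y ↦ cov Z y (X y)) x (Y x)
    - cov Z x (VectorField.mlieBracket I X Y x)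

/-- The curvature endomorphism `R_x(u,v)w` on tangent vectors, computed through extensions of
`u`, `v`, `w` to vector fields that are smooth near `x`. -/
def curvature (x : M) (u v w : TangentSpace I x) : TangentSpace I x :=
  curvatureField cov (FiberBundle.extend E u) (FiberBundle.extend E v) (FiberBundle.extend E w) x

/-- The covariant derivative `(∇_U R)(X,Y)Z` of the curvature on vector fields. -/
def covCurvatureField (U X Y Z : Π x : M, TangentSpace I x) (x : M) : TangentSpace I x :=
  cov (fun y ↦ curvature cov y (X y) (Y y) (Z y)) x (U x)
    - curvature cov x (cov X x (U x)) (Y x) (Z x)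
    - curvature cov x (X x) (cov Y x (U x)) (Z x)
    - curvature cov x (X x) (Y x) (cov Z x (U x))

/-- `(∇_u R)(v,w)z` on tangent vectors at `x`, again through extensions. -/
def covCurvature (x : M) (u v w z : TangentSpace I x) : TangentSpace I x :=
  covCurvatureField cov (FiberBundle.extend E u) (FiberBundle.extend E v)
    (FiberBundle.extend E w) (FiberBundle.extend E z) x

variable (I) in
/-- The velocity of a curve `γ` parametrised by `s ⊆ ℝ` (one-sided at end points). -/
def velocity (γ : ℝ → M) (s : Set ℝ) (t : ℝ) : TangentSpace I (γ t) :=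
  mfderivWithin 𝓘(ℝ, ℝ) I γ s t (1 : ℝ)

variable (I) in
/-- Vector fields along the curve `γ`. -/
abbrev FieldAlong (γ : ℝ → M) : Type _ := Π t : ℝ, TangentSpace I (γ t)

/-- The field `X` along `γ` is smooth on `s`. -/
def SmoothAlong {γ : ℝ → M} (s : Set ℝ) (X : FieldAlong I γ) : Prop :=
  ContMDiffOn 𝓘(ℝ, ℝ) I.tangent ∞ (fun t ↦ (⟨γ t, X t⟩ : TangentBundle I M)) s

/-- The covariant derivative `D_t X` of a vector field along `γ`. Near `t`, write
`X = ∑ Xⁱ eᵢ(γ)` in a local frame `(eᵢ)` around `γ t`, coming from a trivialization of the tangent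
bundle; then `D_t X = ∑ (Xⁱ)' eᵢ + ∑ Xⁱ ∇_γ' eᵢ`. The two terms below are these two sums. -/
def covAlong {γ : ℝ → M} (s : Set ℝ) (X : FieldAlong I γ) : FieldAlong I γ := fun t ↦
  (trivializationAt E (fun x : M ↦ TangentSpace I x) (γ t)).symm (γ t)
      (derivWithin
        (fun τ ↦ (trivializationAt E (fun x : M ↦ TangentSpace I x) (γ t) ⟨γ τ, X τ⟩).2) s t)
    + cov (FiberBundle.extend E (X t)) (γ t) (velocity I γ s t)

/-- Operators with the type of a (1,3)-tensor along `γ`. -/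
abbrev TensorAlong (I : ModelWithCorners ℝ E H) (γ : ℝ → M) : Type _ :=
  FieldAlong I γ → FieldAlong I γ → FieldAlong I γ → FieldAlong I γ

/-- The curvature along `γ`. -/
def curvatureAlong (γ : ℝ → M) : TensorAlong I γ :=
  fun X Y Z t ↦ curvature cov (γ t) (X t) (Y t) (Z t)

/-- The covariant derivative along `γ` of a (1,3)-tensor along `γ`:
`(D_t T)(X,Y)Z = D_t (T(X,Y)Z) - T(D_t X,Y)Z - T(X,D_t Y)Z - T(X,Y) D_t Z`. -/
def tensorCovAlong {γ : ℝ → M} (s : Set ℝ) (T : TensorAlong I γ) : TensorAlong I γ :=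
  fun X Y Z ↦ covAlong cov s (T X Y Z) - T (covAlong cov s X) Y Z - T X (covAlong cov s Y) Z
    - T X Y (covAlong cov s Z)

/-- The vector field `F(X, γ')` along `γ`, with `Y = γ'`, `DY = D_t γ'` and `D2Y = D_t² γ'`. -/
def bigF (γ : ℝ → M) (s : Set ℝ) (X : FieldAlong I γ) : FieldAlong I γ :=
  let Y : FieldAlong I γ := velocity I γ s
  let DY := covAlong cov s Y
  let D2Y := covAlong cov s DY
  let DX := covAlong cov s X
  let D2X := covAlong cov s DX
  let R := curvatureAlong cov γ
  let DR := tensorCovAlong cov s R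
  let D2R := tensorCovAlong cov s DR
  D2R X Y Y + (fun t ↦ covCurvature cov (γ t) (X t) (DY t) (Y t) (Y t)) + R (R X Y Y) Y Y
    + R X D2Y Y + 4 • R DX Y DY
    + 2 • (DR DX Y Y + DR X DY Y + R D2X Y Y)
    + 3 • (DR X Y DY + R X Y D2Y + R X DY DY)

end Connection

section Cubics

variable {E : Type*} [NormedAddCommGroup E] [NormedSpace ℝ E] [FiniteDimensional ℝ E]
  {H : Type*} [TopologicalSpace H] (I : ModelWithCorners ℝ E H)
  {M : Type*} [TopologicalSpace M] [ChartedSpace H M] [IsManifold I ∞ M]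
  [RiemannianBundle (fun x : M ↦ TangentSpace I x)]
  [IsContMDiffRiemannianBundle I ∞ E (fun x : M ↦ TangentSpace I x)]

/-- `γ` is a modified Riemannian cubic on `[a, b]` for the potential `V`: it is smooth and
`D_t³ γ' + R(D_t γ', γ')γ' = - grad V(γ)`. -/
structure IsModifiedCubic (V : M → ℝ) (a b : ℝ) (γ : ℝ → M) : Prop where
  smooth : ContMDiffOn 𝓘(ℝ, ℝ) I ∞ γ (Icc a b)
  eqn : ∀ t ∈ Icc a b,
    letI D : FieldAlong I γ → FieldAlong I γ := covAlong (leviCivita I M) (Icc a b)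
    letI T : FieldAlong I γ := velocity I γ (Icc a b)
    D (D (D T)) t + curvature (leviCivita I M) (γ t) (D T t) (T t) (T t) = - grad I V (γ t)

/-- `X` is a modified bi-Jacobi field along `γ` on `[a, b]`: it is smooth and
`D_t⁴ X + F(X, γ') + ∇_X grad V(γ) = 0`. -/
structure IsModifiedBiJacobi (V : M → ℝ) (a b : ℝ) (γ : ℝ → M) (X : FieldAlong I γ) : Prop where
  smooth : SmoothAlong (Icc a b) X
  eqn : ∀ t ∈ Icc a b,
    letI D : FieldAlong I γ → FieldAlong I γ := covAlong (leviCivita I M) (Icc a b)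
    D (D (D (D X))) t + bigF (leviCivita I M) γ (Icc a b) X t
      + leviCivita I M (grad I V) (γ t) (X t) = 0

end Cubics

section Group

variable {E : Type*} [NormedAddCommGroup E] [NormedSpace ℝ E] [FiniteDimensional ℝ E]
  {H : Type*} [TopologicalSpace H] (I : ModelWithCorners ℝ E H)
  {G : Type*} [TopologicalSpace G] [ChartedSpace H G] [Group G]

/-- Left translation of tangent vectors to the identity, `v ↦ g⁻¹ v`. -/
def leftToId (g : G) (v : TangentSpace I g) : TangentSpace I (1 : G) :=
  mfderiv I I (fun x : G ↦ g⁻¹ * x) g v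

/-- The Riemannian metric is left-invariant: `⟨v, w⟩_g = ⟨g⁻¹ v, g⁻¹ w⟩_e`. -/
def IsLeftInvariantMetric (I : ModelWithCorners ℝ E H) (G : Type*) [TopologicalSpace G]
    [ChartedSpace H G] [Group G] [RiemannianBundle (fun x : G ↦ TangentSpace I x)] : Prop :=
  ∀ (g : G) (v w : TangentSpace I g),
    (inner ℝ v w : ℝ) = inner ℝ (leftToId I g v) (leftToId I g w)

variable [LieGroup I ∞ G] [RiemannianBundle (fun x : G ↦ TangentSpace I x)]
  [IsContMDiffRiemannianBundle I ∞ E (fun x : G ↦ TangentSpace I x)]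

/-- The Riemannian `𝔤`-connection `∇^𝔤_ξ η = (∇_φ(ξ) φ(η))(e)`, where `φ(ξ)` is the left-invariant
vector field with value `ξ` at the identity. -/
def gConn (ξ η : TangentSpace I (1 : G)) : TangentSpace I (1 : G) :=
  leviCivita I G (mulInvariantVectorField η) 1 (mulInvariantVectorField ξ 1)

/-- The curvature at the identity. -/
def gCurv (x y z : TangentSpace I (1 : G)) : TangentSpace I (1 : G) :=
  curvature (leviCivita I G) (1 : G) x y z

/-- For a trilinear `T : 𝔤³ → 𝔤`, the derivation action of `∇^𝔤_w` on `T`: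
`∇^𝔤_w (T(x,y,z)) - T(∇^𝔤_w x,y,z) - T(x,∇^𝔤_w y,z) - T(x,y,∇^𝔤_w z)`. -/
def gAct (w : TangentSpace I (1 : G))
    (T : TangentSpace I (1 : G) → TangentSpace I (1 : G) → TangentSpace I (1 : G) → TangentSpace I (1 : G))
    (x y z : TangentSpace I (1 : G)) : TangentSpace I (1 : G) :=
  gConn I w (T x y z) - T (gConn I w x) y z - T x (gConn I w y) z - T x y (gConn I w z)

/-- The derivative `η' + ∇^𝔤_ξ η` of a curve `η` in `𝔤`. -/
def gDeriv (s : Set ℝ) (ξ η : ℝ → TangentSpace I (1 : G)) (t : ℝ) : TangentSpace I (1 : G) :=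
  derivWithin η s t + gConn I (ξ t) (η t)

/-- The reduced form `𝓕(x₀,x₁,x₂,ξ₀,ξ₁,ξ₂)` of `F`; here `ξ₁ - ∇^𝔤_ξ₀ ξ₀` stands for the time
derivative of `ξ₀`. -/
def gF (x₀ x₁ x₂ ξ₀ ξ₁ ξ₂ : TangentSpace I (1 : G)) : TangentSpace I (1 : G) :=
  let R := gCurv I (G := G)
  let DR := gAct I ξ₀ R
  let D2R := fun x y z ↦ gAct I (ξ₁ - gConn I ξ₀ ξ₀) R x y z + gAct I ξ₀ DR x y z
  D2R x₀ ξ₀ ξ₀ + gAct I x₀ R ξ₁ ξ₀ ξ₀ + R (R x₀ ξ₀ ξ₀) ξ₀ ξ₀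
    + R x₀ ξ₂ ξ₀ + 4 • R x₁ ξ₀ ξ₁
    + 2 • (DR x₁ ξ₀ ξ₀ + DR x₀ ξ₁ ξ₀ + R x₂ ξ₀ ξ₀)
    + 3 • (DR x₀ ξ₀ ξ₁ + R x₀ ξ₀ ξ₂ + R x₀ ξ₁ ξ₁)

/-- `(D_x + ∇^𝔤_x) grad₁ V_ext(e, h)`. The operator `D_x` differentiates at `e`, in the direction
`x`, the components of `grad₁ V_ext(·, h)` in a left-invariant frame, that is, the `𝔤`-valued
function `q ↦ q⁻¹ grad₁ V_ext(q, h)`. -/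
def gHess (Vext : G → G → ℝ) (h : G) (x : TangentSpace I (1 : G)) : TangentSpace I (1 : G) :=
  mvfderiv I (fun q : G ↦ leftToId I q (grad I (fun p ↦ Vext p h) q)) 1 x
    + gConn I x (grad I (fun p ↦ Vext p h) 1)

/-- `χ₀ : [a, b] → 𝔤` is a reduced bi-Jacobi field: a smooth solution, for `ξ₀`, `ξ₁`, `ξ₂`, and
`h : [a, b] → G`, of the recursive system together with the reduced fourth-order equation. -/
def IsReducedBiJacobi (Vext : G → G → ℝ) (a b : ℝ) (ξ₀ ξ₁ ξ₂ : ℝ → TangentSpace I (1 : G))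
    (h : ℝ → G) (χ₀ : ℝ → TangentSpace I (1 : G)) : Prop :=
  ContDiffOn ℝ ∞ χ₀ (Icc a b) ∧
  ∃ χ₁ χ₂ χ₃ : ℝ → TangentSpace I (1 : G),
    (∀ t ∈ Icc a b, χ₁ t = gDeriv I (Icc a b) ξ₀ χ₀ t) ∧
    (∀ t ∈ Icc a b, χ₂ t = gDeriv I (Icc a b) ξ₀ χ₁ t) ∧
    (∀ t ∈ Icc a b, χ₃ t = gDeriv I (Icc a b) ξ₀ χ₂ t) ∧
    ∀ t ∈ Icc a b,
      0 = gDeriv I (Icc a b) ξ₀ χ₃ t + gHess I Vext (h t) (χ₀ t)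
        + gF I (χ₀ t) (χ₁ t) (χ₂ t) (ξ₀ t) (ξ₁ t) (ξ₂ t)

end Group

end RiemCubic
end

set_option linter.unusedSectionVars false
set_option linter.style.haveILetI false

noncomputable section

namespace RiemCubic

section LeftInvariant

variable {E : Type*} [NormedAddCommGroup E] [NormedSpace ℝ E] [FiniteDimensional ℝ E]
  {H : Type*} [TopologicalSpace H] {I : ModelWithCorners ℝ E H}
  {G : Type*} [TopologicalSpace G] [ChartedSpace H G] [Group G] [LieGroup I ∞ G]

theorem lieGroup_minSmoothness : LieGroup I (minSmoothness ℝ 3) G := by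
  rw [minSmoothness_of_isRCLikeNormedField]; infer_instance

theorem mdifferentiableAt_mul_left (k q : G) : MDiffAt (fun x : G ↦ k * x) q :=
  (contMDiff_mul_left (I := I) (n := ∞)).mdifferentiable (by simp) q

theorem mfderiv_congr_base (f : G → G) {x y : G} (h : x = y) :
    (mfderiv I I f x : E →L[ℝ] E) = mfderiv I I f y := by
  subst h; rfl

theorem tangentBundle_mk_congr {x y : G} (h : x = y) {v w : E} (hvw : v = w) :
    (TotalSpace.mk' E x v : TangentBundle I G) = TotalSpace.mk' E y w := by
  subst h hvw; rfl

@[simp]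
theorem leftToId_mulInvariantVectorField (q : G) (v : TangentSpace I (1 : G)) :
    leftToId I q (mulInvariantVectorField v q) = v := by
  have h := mfderiv_comp_of_eq (I := I) (I' := I) (I'' := I) (f := fun x : G ↦ q * x)
    (g := fun x : G ↦ q⁻¹ * x) (x := 1) (y := q)
    (mdifferentiableAt_mul_left _ _) (mdifferentiableAt_mul_left _ _) (mul_one q)
  have e : (fun x : G ↦ q⁻¹ * x) ∘ (fun x : G ↦ q * x) = id := by ext; simp
  rw [e, mfderiv_id] at h
  exact (congrArg (fun A : E →L[ℝ] E ↦ A (mfderiv I I (fun x : G ↦ q * x) 1 v))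
    (mfderiv_congr_base _ (mul_one q))).symm.trans (congrArg (fun A ↦ A v) h).symm

@[simp]
theorem mulInvariantVectorField_leftToId (q : G) (v : TangentSpace I q) :
    mulInvariantVectorField (leftToId I q v) q = v := by
  have h := mfderiv_comp_of_eq (I := I) (I' := I) (I'' := I) (f := fun x : G ↦ q⁻¹ * x)
    (g := fun x : G ↦ q * x) (x := q) (y := 1)
    (mdifferentiableAt_mul_left _ _) (mdifferentiableAt_mul_left _ _) (inv_mul_cancel q)
  have e : (fun x : G ↦ q * x) ∘ (fun x : G ↦ q⁻¹ * x) = id := by ext; simp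
  rw [e, mfderiv_id] at h
  exact (congrArg (fun A : E →L[ℝ] E ↦ A (mfderiv I I (fun x : G ↦ q⁻¹ * x) q v))
    (mfderiv_congr_base _ (inv_mul_cancel q))).symm.trans (congrArg (fun A ↦ A v) h).symm

@[simp]
theorem mulInvariantVectorField_one (v : TangentSpace I (1 : G)) :
    mulInvariantVectorField v (1 : G) = v := by
  have key : ∀ f : G → G, f = id → (mfderiv I I f 1 : E →L[ℝ] E) v = v := by
    rintro f rfl
    exact congrArg (fun A : E →L[ℝ] E ↦ A v) (mfderiv_id (I := I) (x := (1 : G)))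
  exact key _ (funext one_mul)

@[simp]
theorem leftToId_one (v : TangentSpace I (1 : G)) : leftToId I (1 : G) v = v := by
  simpa using leftToId_mulInvariantVectorField (1 : G) v

theorem leftToId_add (q : G) (v w : TangentSpace I q) :
    leftToId I q (v + w) = leftToId I q v + leftToId I q w :=
  map_add (mfderiv I I (fun x : G ↦ q⁻¹ * x) q) v w

theorem leftToId_smul (q : G) (c : ℝ) (v : TangentSpace I q) :
    leftToId I q (c • v) = c • leftToId I q v :=
  map_smul (mfderiv I I (fun x : G ↦ q⁻¹ * x) q) c v

theorem leftToId_sub (q : G) (v w : TangentSpace I q) :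
    leftToId I q (v - w) = leftToId I q v - leftToId I q w :=
  map_sub (mfderiv I I (fun x : G ↦ q⁻¹ * x) q) v w

theorem leftToId_injective (q : G) : Function.Injective (leftToId I q) :=
  Function.LeftInverse.injective (mulInvariantVectorField_leftToId q)

theorem contMDiff_mulInvariantVectorField_infty (v : TangentSpace I (1 : G)) :
    ContMDiff I I.tangent ∞
      (fun q : G ↦ (mulInvariantVectorField v q : TangentBundle I G)) := by
  let fg : G → TangentBundle I G := fun g ↦ TotalSpace.mk' E g 0
  have sfg : ContMDiff I I.tangent ∞ fg := contMDiff_zeroSection _ _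
  let fv : G → TangentBundle I G := fun _ ↦ TotalSpace.mk' E 1 v
  have sfv : ContMDiff I I.tangent ∞ fv := contMDiff_const
  have S₂ : ContMDiff (I.tangent.prod I.tangent) (I.prod I).tangent ∞
      (equivTangentBundleProd I G I G).symm := contMDiff_equivTangentBundleProd_symm
  have S₃ : ContMDiff (I.prod I).tangent I.tangent ∞
      (tangentMap (I.prod I) I (fun p : G × G ↦ p.1 * p.2)) :=
    ContMDiff.contMDiff_tangentMap (contMDiff_mul I ∞) (by simp)
  convert (S₃.comp S₂).comp (sfg.prodMk sfv) using 1
  funext g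
  refine tangentBundle_mk_congr (mul_one g).symm ?_
  have h := mfderiv_prod_eq_add_apply (I := I) (I' := I) (I'' := I)
    (f := fun p : G × G ↦ p.1 * p.2) (p := (g, 1)) (v := ((0 : E), v))
    ((contMDiff_mul I ∞).mdifferentiable (by simp) _)
  refine Eq.trans ?_ h.symm
  exact ((congrArg (· + _) (map_zero (mfderiv I I (fun x : G ↦ x * 1) g))).trans (zero_add _)).symm

theorem mdifferentiableAt_mulInvariantVectorField_infty (v : TangentSpace I (1 : G)) (q : G) :
    MDiffAt (T% (mulInvariantVectorField v)) q :=
  (contMDiff_mulInvariantVectorField_infty v).mdifferentiable (by simp) q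

variable [RiemannianBundle (fun x : G ↦ TangentSpace I x)]
  [IsContMDiffRiemannianBundle I ∞ E (fun x : G ↦ TangentSpace I x)]

theorem IsLeftInvariantMetric.inner_mulInvariantVectorField (hinv : IsLeftInvariantMetric I G)
    (q : G) (v w : TangentSpace I (1 : G)) :
    (inner ℝ (mulInvariantVectorField v q) (mulInvariantVectorField w q) : ℝ) = inner ℝ v w := by
  rw [hinv q]; simp

theorem IsLeftInvariantMetric.inner_mulInvariantVectorField_right
    (hinv : IsLeftInvariantMetric I G) (q : G) (v : TangentSpace I q) (w : TangentSpace I (1 : G)) :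
    (inner ℝ v (mulInvariantVectorField w q) : ℝ) = inner ℝ (leftToId I q v) w := by
  rw [hinv q]; simp

theorem mulInvariantVector_mlieBracket_apply (ξ η : TangentSpace I (1 : G)) (q : G) :
    VectorField.mlieBracket I (mulInvariantVectorField ξ) (mulInvariantVectorField η) q =
      mulInvariantVectorField (VectorField.mlieBracket I (mulInvariantVectorField ξ)
        (mulInvariantVectorField η) (1 : G)) q := by
  haveI : LieGroup I (minSmoothness ℝ 3) G := lieGroup_minSmoothness
  haveI : CompleteSpace E := FiniteDimensional.complete ℝ E
  rw [mulInvariantVector_mlieBracket]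

theorem IsLeftInvariantMetric.koszul_mulInvariantVectorField (hinv : IsLeftInvariantMetric I G)
    (ξ η ζ : TangentSpace I (1 : G)) (q : G) :
    koszul I (mulInvariantVectorField ξ) (mulInvariantVectorField η) (mulInvariantVectorField ζ) q
      = koszul I (mulInvariantVectorField ξ) (mulInvariantVectorField η)
        (mulInvariantVectorField ζ) 1 := by
  simp only [koszul, hinv.inner_mulInvariantVectorField, mvfderiv_const]
  simp only [mulInvariantVector_mlieBracket_apply _ _ q, hinv.inner_mulInvariantVectorField]
  simp

theorem IsLeftInvariantMetric.leviCivita_mulInvariantVectorField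
    (hinv : IsLeftInvariantMetric I G) (ξ η : TangentSpace I (1 : G)) (q : G) :
    leviCivita I G (mulInvariantVectorField η) q (mulInvariantVectorField ξ q) =
      mulInvariantVectorField (gConn I ξ η) q := by
  refine ext_inner_right ℝ fun w ↦ ?_
  rw [← mulInvariantVectorField_leftToId q w, hinv.inner_mulInvariantVectorField,
    inner_leviCivita (mdifferentiableAt_mulInvariantVectorField_infty _ _)
    (mdifferentiableAt_mulInvariantVectorField_infty _ _)
    (mdifferentiableAt_mulInvariantVectorField_infty _ _), hinv.koszul_mulInvariantVectorField,
    ← inner_leviCivita (mdifferentiableAt_mulInvariantVectorField_infty _ _)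
    (mdifferentiableAt_mulInvariantVectorField_infty _ _)
    (mdifferentiableAt_mulInvariantVectorField_infty _ _)]
  simp [gConn]

theorem gConn_add_left (ξ ξ' η : TangentSpace I (1 : G)) :
    gConn I (ξ + ξ') η = gConn I ξ η + gConn I ξ' η := by
  simp [gConn]

theorem gConn_smul_left (c : ℝ) (ξ η : TangentSpace I (1 : G)) :
    gConn I (c • ξ) η = c • gConn I ξ η := by
  simp [gConn]

theorem gConn_add_right (ξ η η' : TangentSpace I (1 : G)) :
    gConn I ξ (η + η') = gConn I ξ η + gConn I ξ η' := by
  simp only [gConn, mulInvariantVectorField_add]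
  rw [(leviCivita I G).isCovariantDerivativeOnUniv.add
    (mdifferentiableAt_mulInvariantVectorField_infty _ _)
    (mdifferentiableAt_mulInvariantVectorField_infty _ _)]
  rfl

theorem gConn_smul_right (c : ℝ) (ξ η : TangentSpace I (1 : G)) :
    gConn I ξ (c • η) = c • gConn I ξ η := by
  simp only [gConn, mulInvariantVectorField_smul]
  rw [(leviCivita I G).isCovariantDerivativeOnUniv.smul_const c
    (mdifferentiableAt_mulInvariantVectorField_infty _ _)]
  rfl

variable (I G) in
/-- The Riemannian `𝔤`-connection as a continuous bilinear map. -/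
def gConnL : TangentSpace I (1 : G) →L[ℝ] TangentSpace I (1 : G) →L[ℝ] TangentSpace I (1 : G) :=
  LinearMap.toContinuousBilinearMap
    (LinearMap.mk₂ ℝ (gConn I) gConn_add_left gConn_smul_left gConn_add_right gConn_smul_right)

@[simp]
theorem gConnL_apply (ξ η : TangentSpace I (1 : G)) : gConnL I G ξ η = gConn I ξ η := rfl

end LeftInvariant

section Trivialization

variable {E : Type*} [NormedAddCommGroup E] [NormedSpace ℝ E] [FiniteDimensional ℝ E]
  {H : Type*} [TopologicalSpace H] {I : ModelWithCorners ℝ E H}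
  {G : Type*} [TopologicalSpace G] [ChartedSpace H G] [Group G] [LieGroup I ∞ G]
  [RiemannianBundle (fun x : G ↦ TangentSpace I x)]
  [IsContMDiffRiemannianBundle I ∞ E (fun x : G ↦ TangentSpace I x)]
  {E' : Type*} [NormedAddCommGroup E'] [NormedSpace ℝ E']
  {H' : Type*} [TopologicalSpace H'] {J : ModelWithCorners ℝ E' H'}
  {M : Type*} [TopologicalSpace M] [ChartedSpace H' M]

/-- Left translation to the identity as a continuous linear map. -/
def leftToIdL (q : G) : TangentSpace I q →L[ℝ] TangentSpace I (1 : G) :=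
  LinearMap.toContinuousLinearMap
    { toFun := leftToId I q
      map_add' := leftToId_add q
      map_smul' := leftToId_smul q }

@[simp]
theorem leftToIdL_apply (q : G) (v : TangentSpace I q) : leftToIdL q v = leftToId I q v := rfl

variable (I G) in
/-- An orthonormal basis of the Lie algebra. -/
def lieFrame : OrthonormalBasis (Fin (Module.finrank ℝ (TangentSpace I (1 : G)))) ℝ
    (TangentSpace I (1 : G)) := stdOrthonormalBasis ℝ (TangentSpace I (1 : G))

theorem IsLeftInvariantMetric.leftToId_eq_sum (hinv : IsLeftInvariantMetric I G) (q : G)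
    (v : TangentSpace I q) :
    leftToId I q v =
      ∑ i, (inner ℝ v (mulInvariantVectorField (lieFrame I G i) q) : ℝ) • lieFrame I G i := by
  conv_lhs => rw [← (lieFrame I G).sum_repr' (leftToId I q v)]
  refine Finset.sum_congr rfl fun i _ ↦ ?_
  rw [hinv.inner_mulInvariantVectorField_right, real_inner_comm]

theorem mulInvariantVectorField_eq_sum (v : TangentSpace I (1 : G)) (q : G) :
    mulInvariantVectorField v q = ∑ i, (inner ℝ (lieFrame I G i) v : ℝ) •
      mulInvariantVectorField (lieFrame I G i) q := by
  conv_lhs => rw [← (lieFrame I G).sum_repr' v]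
  simp only [mulInvariantVectorField]
  rw [map_sum]
  simp only [map_smul]
  rfl

theorem IsLeftInvariantMetric.contMDiffWithinAt_leftToId (hinv : IsLeftInvariantMetric I G)
    {b : M → G} {v : ∀ m, TangentSpace I (b m)} {s : Set M} {x : M}
    (hv : ContMDiffWithinAt J I.tangent ∞ (fun m ↦ (v m : TangentBundle I G)) s x) :
    ContMDiffWithinAt J 𝓘(ℝ, TangentSpace I (1 : G)) ∞ (fun m ↦ leftToId I (b m) (v m)) s x := by
  have hb : ContMDiffWithinAt J I ∞ b s x := (contMDiffWithinAt_totalSpace.1 hv).1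
  simp only [hinv.leftToId_eq_sum]
  refine ContMDiffWithinAt.sum fun i _ ↦ ?_
  have h := ContMDiffWithinAt.inner_bundle (F := E) (E := fun x : G ↦ TangentSpace I x) (IB := I) hv
    ((contMDiff_mulInvariantVectorField_infty (lieFrame I G i)).contMDiffAt.comp_contMDiffWithinAt
      x hb)
  exact h.smul contMDiffWithinAt_const

theorem IsLeftInvariantMetric.mdifferentiableWithinAt_leftToId (hinv : IsLeftInvariantMetric I G)
    {b : M → G} {v : ∀ m, TangentSpace I (b m)} {s : Set M} {x : M}
    (hv : MDifferentiableWithinAt J I.tangent (fun m ↦ (v m : TangentBundle I G)) s x) :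
    MDifferentiableWithinAt J 𝓘(ℝ, TangentSpace I (1 : G)) (fun m ↦ leftToId I (b m) (v m)) s x := by
  have hb : MDifferentiableWithinAt J I b s x := (mdifferentiableWithinAt_totalSpace ..).1 hv |>.1
  simp only [hinv.leftToId_eq_sum]
  rw [← Finset.sum_fn]
  refine MDifferentiableWithinAt.sum fun i _ ↦ ?_
  have h := MDifferentiableWithinAt.inner_bundle (F := E) (E := fun x : G ↦ TangentSpace I x)
    (IB := I) hv ((mdifferentiableAt_mulInvariantVectorField_infty
      (lieFrame I G i) (b x)).comp_mdifferentiableWithinAt x hb)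
  exact h.smul mdifferentiableWithinAt_const

theorem contMDiffWithinAt_mulInvariantVectorField_along {b : M → G}
    {c : M → TangentSpace I (1 : G)} {s : Set M} {x : M} (hb : ContMDiffWithinAt J I ∞ b s x)
    (hc : ContMDiffWithinAt J 𝓘(ℝ, TangentSpace I (1 : G)) ∞ c s x) :
    ContMDiffWithinAt J I.tangent ∞
      (fun m ↦ (⟨b m, mulInvariantVectorField (c m) (b m)⟩ : TangentBundle I G)) s x := by
  rw [contMDiffWithinAt_totalSpace]
  refine ⟨hb, ?_⟩
  have key : ContMDiffWithinAt J 𝓘(ℝ, E) ∞ (fun m ↦ ∑ i, (inner ℝ (lieFrame I G i) (c m) : ℝ) •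
      (trivializationAt E (fun x : G ↦ TangentSpace I x) (b x)
        ⟨b m, mulInvariantVectorField (lieFrame I G i) (b m)⟩).2) s x := by
    refine ContMDiffWithinAt.sum fun i _ ↦ ?_
    have h := (innerSL ℝ (lieFrame I G i)).contMDiff.contMDiffAt.comp_contMDiffWithinAt x hc
    exact h.smul (contMDiffWithinAt_totalSpace.1
      ((contMDiff_mulInvariantVectorField_infty
        (lieFrame I G i)).contMDiffAt.comp_contMDiffWithinAt x hb)).2
  have hmem : ∀ᶠ m in nhdsWithin x s,
      b m ∈ (trivializationAt E (fun x : G ↦ TangentSpace I x) (b x)).baseSet :=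
    hb.continuousWithinAt.eventually_mem
      ((trivializationAt E (fun x : G ↦ TangentSpace I x) (b x)).open_baseSet.mem_nhds
      (FiberBundle.mem_baseSet_trivializationAt' _))
  have heq : ∀ m, b m ∈ (trivializationAt E (fun x : G ↦ TangentSpace I x) (b x)).baseSet →
      (trivializationAt E (fun x : G ↦ TangentSpace I x) (b x)
        ⟨b m, mulInvariantVectorField (c m) (b m)⟩).2 =
      ∑ i, (inner ℝ (lieFrame I G i) (c m) : ℝ) •
      (trivializationAt E (fun x : G ↦ TangentSpace I x) (b x)
        ⟨b m, mulInvariantVectorField (lieFrame I G i) (b m)⟩).2 := by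
    intro m hm
    set t := trivializationAt E (fun x : G ↦ TangentSpace I x) (b x)
    have e : ∀ w : TangentSpace I (b m), (t ⟨b m, w⟩).2 = t.continuousLinearMapAt ℝ (b m) w := by
      intro w
      rw [t.continuousLinearMapAt_apply ℝ, t.coe_linearMapAt_of_mem hm]
    simp only [e]
    rw [mulInvariantVectorField_eq_sum (c m), map_sum]
    simp only [map_smul]
  refine key.congr_of_eventuallyEq (hmem.mono heq) (heq _ ?_)
  exact FiberBundle.mem_baseSet_trivializationAt' _

theorem contMDiff_mulInvariantVectorField_prod :
    ContMDiff (I.prod 𝓘(ℝ, TangentSpace I (1 : G))) I.tangent ∞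
      (fun p : G × TangentSpace I (1 : G) ↦
        (⟨p.1, mulInvariantVectorField p.2 p.1⟩ : TangentBundle I G)) := fun _ ↦
  contMDiffWithinAt_mulInvariantVectorField_along contMDiff_fst.contMDiffAt
    contMDiff_snd.contMDiffAt

theorem mdifferentiableWithinAt_mulInvariantVectorField_along {b : M → G}
    {c : M → TangentSpace I (1 : G)} {s : Set M} {x : M} (hb : MDifferentiableWithinAt J I b s x)
    (hc : MDifferentiableWithinAt J 𝓘(ℝ, TangentSpace I (1 : G)) c s x) :
    MDifferentiableWithinAt J I.tangent
      (fun m ↦ (⟨b m, mulInvariantVectorField (c m) (b m)⟩ : TangentBundle I G)) s x :=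
  ((contMDiff_mulInvariantVectorField_prod (I := I) (G := G)).mdifferentiable (by simp)
    (b x, c x)).comp_mdifferentiableWithinAt x (hb.prodMk hc)

/-- The left trivialization of a vector field. -/
def leftField (Y : Π x : G, TangentSpace I x) (q : G) : TangentSpace I (1 : G) :=
  leftToId I q (Y q)

theorem IsLeftInvariantMetric.mdifferentiableAt_leftField (hinv : IsLeftInvariantMetric I G)
    {Y : Π x : G, TangentSpace I x} {q : G} (hY : MDiffAt (T% Y) q) :
    MDifferentiableAt I 𝓘(ℝ, TangentSpace I (1 : G)) (leftField Y) q :=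
  mdifferentiableWithinAt_univ.1 (hinv.mdifferentiableWithinAt_leftToId
    (mdifferentiableWithinAt_univ.2 hY))

theorem IsLeftInvariantMetric.contMDiffAt_leftField (hinv : IsLeftInvariantMetric I G)
    {Y : Π x : G, TangentSpace I x} {q : G}
    (hY : ContMDiffAt I I.tangent ∞ (fun x ↦ (Y x : TangentBundle I G)) q) :
    ContMDiffAt I 𝓘(ℝ, TangentSpace I (1 : G)) ∞ (leftField Y) q :=
  hinv.contMDiffWithinAt_leftToId hY

theorem mdifferentiableAt_of_leftField {Y : Π x : G, TangentSpace I x} {q : G}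
    (hY : MDifferentiableAt I 𝓘(ℝ, TangentSpace I (1 : G)) (leftField Y) q) :
    MDiffAt (T% Y) q := by
  have := mdifferentiableWithinAt_mulInvariantVectorField_along (b := fun x : G ↦ x)
    (s := univ) (x := q) mdifferentiableWithinAt_id (mdifferentiableWithinAt_univ.2 hY)
  simpa [leftField, mdifferentiableWithinAt_univ] using this

theorem leviCivita_sum {ι : Type*} (u : Finset ι) {f : ι → G → ℝ}
    {σ : ι → Π x : G, TangentSpace I x} {q : G} (hf : ∀ i, MDiffAt (f i) q)
    (hσ : ∀ i, MDiffAt (T% (σ i)) q) :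
    MDiffAt (T% (∑ i ∈ u, f i • σ i)) q ∧ leviCivita I G (∑ i ∈ u, f i • σ i) q =
      ∑ i ∈ u, (f i q • leviCivita I G (σ i) q + (mvfderiv I (f i) q).smulRight (σ i q)) := by
  classical
  induction u using Finset.induction_on with
  | empty =>
    simp only [Finset.sum_empty, CovariantDerivative.zero]
    exact ⟨mdifferentiableAt_zeroSection .., rfl⟩
  | insert i u hi ih =>
    have h := (hf i).smul_section (hσ i)
    rw [Finset.sum_insert hi, Finset.sum_insert hi]
    refine ⟨mdifferentiableAt_add_section h ih.1, ?_⟩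
    rw [(leviCivita I G).isCovariantDerivativeOnUniv.add h ih.1, ih.2,
      (leviCivita I G).isCovariantDerivativeOnUniv.leibniz (hσ i) (hf i)]

theorem mvfderiv_sum_smul_const {V : Type*} [NormedAddCommGroup V] [NormedSpace ℝ V] {ι : Type}
    (u : Finset ι) {f : ι → G → ℝ} (e : ι → V) {q : G} (hf : ∀ i, MDiffAt (f i) q) :
    mvfderiv I (fun x ↦ ∑ i ∈ u, f i x • e i) q = ∑ i ∈ u, (mvfderiv I (f i) q).smulRight (e i) := by
  have h : HasMFDerivAt I 𝓘(ℝ, V) (fun x ↦ ∑ i ∈ u, f i x • e i) q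
      (∑ i ∈ u, (mvfderiv I (f i) q).smulRight (e i)) := by
    rw [← Finset.sum_fn]
    refine HasMFDerivAt.sum (f := fun i x ↦ f i x • e i)
      (f' := fun i ↦ (mvfderiv I (f i) q).smulRight (e i)) fun i _ ↦ ?_
    have hl : HasMFDerivAt 𝓘(ℝ, ℝ) 𝓘(ℝ, V) (ContinuousLinearMap.toSpanSingleton ℝ (e i)) (f i q)
        (ContinuousLinearMap.toSpanSingleton ℝ (e i)) := ContinuousLinearMap.hasMFDerivAt _
    exact hl.comp q (hf i).hasMFDerivAt
  exact h.mfderiv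

/-- The Levi-Civita connection in the left trivialization. -/
theorem IsLeftInvariantMetric.leftToId_leviCivita (hinv : IsLeftInvariantMetric I G)
    {Y : Π x : G, TangentSpace I x} {q : G} (hY : MDiffAt (T% Y) q) (u : TangentSpace I q) :
    leftToId I q (leviCivita I G Y q u) =
      mvfderiv I (leftField Y) q u + gConn I (leftToId I q u) (leftField Y q) := by
  set f : Fin (Module.finrank ℝ (TangentSpace I (1 : G))) → G → ℝ :=
    fun i x ↦ inner ℝ (Y x) (mulInvariantVectorField (lieFrame I G i) x) with hfdef
  have hf : ∀ i, MDiffAt (f i) q := fun i ↦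
    mdifferentiableAt_inner hY (mdifferentiableAt_mulInvariantVectorField_infty _ _)
  have eY : leftField Y = fun x ↦ ∑ i, f i x • lieFrame I G i := by
    funext x; exact hinv.leftToId_eq_sum x (Y x)
  have eY' : Y = ∑ i, f i • mulInvariantVectorField (lieFrame I G i) := by
    funext x
    rw [← mulInvariantVectorField_leftToId x (Y x), mulInvariantVectorField_eq_sum,
      Finset.sum_apply]
    refine Finset.sum_congr rfl fun i _ ↦ ?_
    rw [real_inner_comm, ← hinv.inner_mulInvariantVectorField_right]
    rfl
  have h := (leviCivita_sum Finset.univ hf fun i ↦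
    mdifferentiableAt_mulInvariantVectorField_infty (lieFrame I G i) q).2
  rw [← eY'] at h
  have hu : u = mulInvariantVectorField (leftToId I q u) q := by simp
  have hc : ∀ i, leftToId I q (leviCivita I G (mulInvariantVectorField (lieFrame I G i)) q u) =
      gConn I (leftToId I q u) (lieFrame I G i) := by
    intro i
    conv_lhs => rw [hu]
    rw [hinv.leviCivita_mulInvariantVectorField, leftToId_mulInvariantVectorField]
  rw [h, eY, mvfderiv_sum_smul_const _ _ hf, ← leftToIdL_apply, ← gConnL_apply]
  simp only [_root_.sum_apply, map_sum, _root_.add_apply, map_add, _root_.smul_apply, map_smul,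
    ContinuousLinearMap.smulRight_apply, leftToIdL_apply, gConnL_apply, hc,
    leftToId_mulInvariantVectorField, Finset.sum_add_distrib]
  rw [add_comm]

end Trivialization

section Commutator

variable {E : Type*} [NormedAddCommGroup E] [NormedSpace ℝ E] [FiniteDimensional ℝ E]
  {H : Type*} [TopologicalSpace H] {I : ModelWithCorners ℝ E H}
  {M : Type*} [TopologicalSpace M] [ChartedSpace H M] [IsManifold I ∞ M]
  {V : Type*} [NormedAddCommGroup V] [NormedSpace ℝ V]

theorem contMDiffAt_mvfderiv_apply {f : M → V} {Y : Π x : M, TangentSpace I x} {x : M}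
    (hf : ContMDiffAt I 𝓘(ℝ, V) ∞ f x) (hY : ContMDiffAt I I.tangent ∞ (T% Y) x) :
    ContMDiffAt I 𝓘(ℝ, V) ∞ (fun y ↦ mvfderiv I f y (Y y)) x := by
  have h := ContMDiffAt.mfderiv_const (m := ∞) hf (by simp)
  have h2 := ContMDiffAt.clm_apply_of_inCoordinates (F₁ := E) (F₂ := V)
    (E₁ := fun x : M ↦ TangentSpace I x) (E₂ := fun x : V ↦ TangentSpace 𝓘(ℝ, V) x)
    (b₁ := fun y : M ↦ y) (b₂ := f) (ϕ := fun y ↦ mfderiv I 𝓘(ℝ, V) f y) h hY hf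
  have h3 := (contMDiffAt_totalSpace.1 h2).2
  simp at h3
  exact h3

theorem ContMDiffAt.eventually_mdifferentiableAt {f : M → V} {x : M}
    (hf : ContMDiffAt I 𝓘(ℝ, V) ∞ f x) : ∀ᶠ y in nhds x, MDifferentiableAt I 𝓘(ℝ, V) f y :=
  ((contMDiffAt_iff_contMDiffAt_nhds (by simp)).1 (hf.of_le (by simp : (1 : ℕ∞ω) ≤ ∞))).mono
    fun _ h ↦ h.mdifferentiableAt (by simp)

theorem ContMDiffAt.eventually_mdifferentiableAt_section {Y : Π x : M, TangentSpace I x} {x : M}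
    (hY : ContMDiffAt I I.tangent ∞ (T% Y) x) : ∀ᶠ y in nhds x, MDiffAt (T% Y) y :=
  ((contMDiffAt_iff_contMDiffAt_nhds (by simp)).1 (hY.of_le (by simp : (1 : ℕ∞ω) ≤ ∞))).mono
    fun _ h ↦ h.mdifferentiableAt (by simp)

theorem contMDiffAt_mlieBracket {U W : Π x : M, TangentSpace I x} {x : M}
    (hU : ContMDiffAt I I.tangent ∞ (T% U) x) (hW : ContMDiffAt I I.tangent ∞ (T% W) x) :
    ContMDiffAt I I.tangent ∞ (T% (VectorField.mlieBracket I U W)) x := by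
  haveI : CompleteSpace E := FiniteDimensional.complete ℝ E
  haveI : IsManifold I (minSmoothness ℝ 2) M := by
    rw [minSmoothness_of_isRCLikeNormedField]; infer_instance
  haveI : IsManifold I (minSmoothness ℝ 3) M := by
    rw [minSmoothness_of_isRCLikeNormedField]; infer_instance
  haveI : IsManifold I ((⊤ : ℕ∞) + 1 : ℕ∞ω) M := inferInstanceAs (IsManifold I ∞ M)
  exact ContMDiffAt.mlieBracket_vectorField (m := ⊤) (n := ⊤) hU hW (by simp)

/-- The commutator of two vector fields, acting on functions, is their Lie bracket. -/
theorem mvfderiv_mlieBracket {f : M → ℝ} {U W : Π x : M, TangentSpace I x} {x : M}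
    (hf : ContMDiffAt I 𝓘(ℝ, ℝ) ∞ f x) (hU : ContMDiffAt I I.tangent ∞ (T% U) x)
    (hW : ContMDiffAt I I.tangent ∞ (T% W) x) :
    mvfderiv I (fun y ↦ mvfderiv I f y (W y)) x (U x)
      - mvfderiv I (fun y ↦ mvfderiv I f y (U y)) x (W x) =
      mvfderiv I f x (VectorField.mlieBracket I U W x) := by
  haveI : CompleteSpace E := FiniteDimensional.complete ℝ E
  haveI : IsManifold I (minSmoothness ℝ 3) M := by
    rw [minSmoothness_of_isRCLikeNormedField]; infer_instance
  by_cases htriv : ∀ w : TangentSpace I x, w = 0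
  · rw [htriv (U x), htriv (W x), htriv (VectorField.mlieBracket I U W x)]; simp
  push Not at htriv
  obtain ⟨z, hz⟩ := htriv
  set Z : Π x : M, TangentSpace I x := FiberBundle.extend E z with hZdef
  have hZ : ContMDiffAt I I.tangent ∞ (T% Z) x := FiberBundle.contMDiffAt_extend I E z
  have hZx : Z x = z := FiberBundle.extend_apply_self E z
  have hfZ : ContMDiffAt I I.tangent ∞ (T% (f • Z)) x := hf.smul_section hZ
  -- the bracket with `f • Z` near `x`
  have step : ∀ A : Π x : M, TangentSpace I x, VectorField.mlieBracket I A (f • Z) =ᶠ[nhds x]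
      ((fun y ↦ mvfderiv I f y (A y)) • Z + f • VectorField.mlieBracket I A Z) := by
    intro A
    filter_upwards [ContMDiffAt.eventually_mdifferentiableAt hf,
      ContMDiffAt.eventually_mdifferentiableAt_section hZ] with y h1 h2
    rw [VectorField.mlieBracket_smul_right h1 h2]
    rfl
  have expand : ∀ A B : Π x : M, TangentSpace I x, ContMDiffAt I I.tangent ∞ (T% A) x →
      ContMDiffAt I I.tangent ∞ (T% B) x →
      VectorField.mlieBracket I A (VectorField.mlieBracket I B (f • Z)) x =
        mvfderiv I (fun y ↦ mvfderiv I f y (B y)) x (A x) • Z x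
        + mvfderiv I f x (B x) • VectorField.mlieBracket I A Z x
        + (mvfderiv I f x (A x) • VectorField.mlieBracket I B Z x
        + f x • VectorField.mlieBracket I A (VectorField.mlieBracket I B Z) x) := by
    intro A B hA hB
    have hd := (contMDiffAt_mvfderiv_apply hf hB).mdifferentiableAt (by simp)
    have hBZ := (contMDiffAt_mlieBracket hB hZ).mdifferentiableAt (by simp)
    have hZ' := hZ.mdifferentiableAt (by simp)
    have hf' := hf.mdifferentiableAt (by simp)
    rw [Filter.EventuallyEq.mlieBracket_vectorField_eq (Filter.EventuallyEq.refl _ A) (step B),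
      VectorField.mlieBracket_add_right (hd.smul_section hZ') (hf'.smul_section hBZ),
      VectorField.mlieBracket_smul_right hd hZ', VectorField.mlieBracket_smul_right hf' hBZ]
  have h2 : minSmoothness ℝ 2 ≤ ∞ := by
    rw [minSmoothness_of_isRCLikeNormedField]; exact ENat.LEInfty.out
  have hjac := VectorField.leibniz_identity_mlieBracket_apply (I := I)
    (hU.of_le h2) (hW.of_le h2) (hfZ.of_le h2)
  have hjac' := VectorField.leibniz_identity_mlieBracket_apply (I := I)
    (hU.of_le h2) (hW.of_le h2) (hZ.of_le h2)
  rw [expand U W hU hW, expand W U hW hU, (step _).self_of_nhds] at hjac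
  simp only [Pi.add_apply, Pi.smul_apply', hjac'] at hjac
  have : (mvfderiv I (fun y ↦ mvfderiv I f y (W y)) x (U x)
      - mvfderiv I (fun y ↦ mvfderiv I f y (U y)) x (W x)
      - mvfderiv I f x (VectorField.mlieBracket I U W x)) • Z x = 0 := by
    rw [← sub_eq_zero] at hjac
    rw [← hjac]
    module
  rw [hZx] at this
  have := (smul_eq_zero.1 this).resolve_right hz
  linarith

end Commutator

section VectorValued

variable {E : Type*} [NormedAddCommGroup E] [NormedSpace ℝ E]
  {H : Type*} [TopologicalSpace H] {I : ModelWithCorners ℝ E H}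
  {M : Type*} [TopologicalSpace M] [ChartedSpace H M]
  {V : Type*} [NormedAddCommGroup V] [NormedSpace ℝ V]
  {W : Type*} [NormedAddCommGroup W] [NormedSpace ℝ W]
  {Z : Type*} [NormedAddCommGroup Z] [NormedSpace ℝ Z]

theorem _root_.Filter.EventuallyEq.mvfderiv_eq {f g : M → V} {x : M} (h : f =ᶠ[nhds x] g) :
    mvfderiv I f x = mvfderiv I g x :=
  h.mfderiv_eq (I := I) (I' := 𝓘(ℝ, V))

theorem mvfderiv_clm_comp (l : V →L[ℝ] W) {f : M → V} {x : M}
    (hf : MDifferentiableAt I 𝓘(ℝ, V) f x) (u : TangentSpace I x) :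
    mvfderiv I (fun y ↦ l (f y)) x u = l (mvfderiv I f x u) := by
  have hl : HasMFDerivAt 𝓘(ℝ, V) 𝓘(ℝ, W) l (f x) l := ContinuousLinearMap.hasMFDerivAt _
  have h := (hl.comp x hf.hasMFDerivAt).mfderiv
  exact congrArg (fun A : E →L[ℝ] W ↦ A u) h

theorem mvfderiv_bilinear (B : V →L[ℝ] W →L[ℝ] Z) {f : M → V} {g : M → W} {x : M}
    (hf : MDifferentiableAt I 𝓘(ℝ, V) f x) (hg : MDifferentiableAt I 𝓘(ℝ, W) g x)
    (u : TangentSpace I x) :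
    mvfderiv I (fun y ↦ B (f y) (g y)) x u =
      B (mvfderiv I f x u) (g x) + B (f x) (mvfderiv I g x u) := by
  have hB : HasMFDerivAt 𝓘(ℝ, V × W) 𝓘(ℝ, Z) (fun p : V × W ↦ B p.1 p.2) (f x, g x)
      (B.deriv₂ (f x, g x)) :=
    (B.isBoundedBilinearMap.hasFDerivAt (f x, g x)).hasMFDerivAt
  have hfg : HasMFDerivAt I 𝓘(ℝ, V × W) (fun y ↦ (f y, g y)) x
      ((mvfderiv I f x).prod (mvfderiv I g x)) :=
    ⟨hf.hasMFDerivAt.1.prodMk hg.hasMFDerivAt.1, hf.hasMFDerivAt.2.prodMk hg.hasMFDerivAt.2⟩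
  have h := (HasMFDerivAt.comp (f := fun y ↦ (f y, g y)) x hB hfg).mfderiv
  refine (congrArg (fun A : E →L[ℝ] Z ↦ A u) h).trans ?_
  exact add_comm _ _

theorem mdifferentiableAt_bilinear (B : V →L[ℝ] W →L[ℝ] Z) {f : M → V} {g : M → W} {x : M}
    (hf : MDifferentiableAt I 𝓘(ℝ, V) f x) (hg : MDifferentiableAt I 𝓘(ℝ, W) g x) :
    MDifferentiableAt I 𝓘(ℝ, Z) (fun y ↦ B (f y) (g y)) x := by
  have hB : MDifferentiableAt 𝓘(ℝ, V × W) 𝓘(ℝ, Z) (fun p : V × W ↦ B p.1 p.2) (f x, g x) :=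
    B.isBoundedBilinearMap.differentiableAt _ |>.mdifferentiableAt
  exact hB.comp x (hf.prodMk_space hg)

theorem contMDiffAt_bilinear (B : V →L[ℝ] W →L[ℝ] Z) {f : M → V} {g : M → W} {x : M}
    (hf : ContMDiffAt I 𝓘(ℝ, V) ∞ f x) (hg : ContMDiffAt I 𝓘(ℝ, W) ∞ g x) :
    ContMDiffAt I 𝓘(ℝ, Z) ∞ (fun y ↦ B (f y) (g y)) x := by
  have hB : ContMDiffAt 𝓘(ℝ, V × W) 𝓘(ℝ, Z) ∞ (fun p : V × W ↦ B p.1 p.2) (f x, g x) :=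
    B.isBoundedBilinearMap.contDiff.contMDiff.contMDiffAt
  exact hB.comp x (hf.prodMk_space hg)

theorem mvfderiv_trilinear (T : V →L[ℝ] V →L[ℝ] V →L[ℝ] V) {f g h : M → V} {x : M}
    (hf : MDifferentiableAt I 𝓘(ℝ, V) f x) (hg : MDifferentiableAt I 𝓘(ℝ, V) g x)
    (hh : MDifferentiableAt I 𝓘(ℝ, V) h x) (u : TangentSpace I x) :
    mvfderiv I (fun y ↦ T (f y) (g y) (h y)) x u = T (mvfderiv I f x u) (g x) (h x)
      + T (f x) (mvfderiv I g x u) (h x) + T (f x) (g x) (mvfderiv I h x u) := by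
  have h1 := mvfderiv_bilinear (ContinuousLinearMap.id ℝ (V →L[ℝ] V))
    (mdifferentiableAt_bilinear T hf hg) hh u
  have h2 := mvfderiv_bilinear T hf hg u
  simp only [ContinuousLinearMap.id_apply] at h1
  rw [h1, h2, _root_.add_apply]

theorem mdifferentiableAt_trilinear (T : V →L[ℝ] V →L[ℝ] V →L[ℝ] V) {f g h : M → V} {x : M}
    (hf : MDifferentiableAt I 𝓘(ℝ, V) f x) (hg : MDifferentiableAt I 𝓘(ℝ, V) g x)
    (hh : MDifferentiableAt I 𝓘(ℝ, V) h x) :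
    MDifferentiableAt I 𝓘(ℝ, V) (fun y ↦ T (f y) (g y) (h y)) x :=
  mdifferentiableAt_bilinear (ContinuousLinearMap.id ℝ (V →L[ℝ] V))
    (mdifferentiableAt_bilinear T hf hg) hh

/-- The commutator of two vector fields, acting on vector-valued functions, is their Lie bracket. -/
theorem mvfderiv_mlieBracket_vector [FiniteDimensional ℝ E] [IsManifold I ∞ M]
    {f : M → V} {X Y : Π x : M, TangentSpace I x} {x : M}
    (hf : ContMDiffAt I 𝓘(ℝ, V) ∞ f x) (hX : ContMDiffAt I I.tangent ∞ (T% X) x)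
    (hY : ContMDiffAt I I.tangent ∞ (T% Y) x) :
    mvfderiv I (fun y ↦ mvfderiv I f y (Y y)) x (X x)
      - mvfderiv I (fun y ↦ mvfderiv I f y (X y)) x (Y x) =
      mvfderiv I f x (VectorField.mlieBracket I X Y x) := by
  refine (SeparatingDual.eq_iff_forall_dual_eq (R := ℝ)).2 fun l ↦ ?_
  have hl : ContMDiffAt I 𝓘(ℝ, ℝ) ∞ (fun y ↦ l (f y)) x :=
    l.contMDiff.contMDiffAt.comp x hf
  have h := mvfderiv_mlieBracket hl hX hY
  have hev : ∀ A : Π x : M, TangentSpace I x, (fun y ↦ mvfderiv I (fun z ↦ l (f z)) y (A y))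
      =ᶠ[nhds x] fun y ↦ l (mvfderiv I f y (A y)) := fun A ↦ by
    filter_upwards [ContMDiffAt.eventually_mdifferentiableAt hf] with y hy
    exact mvfderiv_clm_comp l hy _
  rw [(hev Y).mvfderiv_eq, (hev X).mvfderiv_eq,
    mvfderiv_clm_comp l ((contMDiffAt_mvfderiv_apply hf hY).mdifferentiableAt (by simp)),
    mvfderiv_clm_comp l ((contMDiffAt_mvfderiv_apply hf hX).mdifferentiableAt (by simp)),
    mvfderiv_clm_comp l (hf.mdifferentiableAt (by simp))] at h
  rw [map_sub, h]

end VectorValued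

section CurvatureTrivialization

variable {E : Type*} [NormedAddCommGroup E] [NormedSpace ℝ E] [FiniteDimensional ℝ E]
  {H : Type*} [TopologicalSpace H] {I : ModelWithCorners ℝ E H}
  {G : Type*} [TopologicalSpace G] [ChartedSpace H G] [Group G] [LieGroup I ∞ G]
  [RiemannianBundle (fun x : G ↦ TangentSpace I x)]
  [IsContMDiffRiemannianBundle I ∞ E (fun x : G ↦ TangentSpace I x)]

theorem IsLeftInvariantMetric.leftField_leviCivita_eventuallyEq (hinv : IsLeftInvariantMetric I G)
    {Y : Π x : G, TangentSpace I x} (X : Π x : G, TangentSpace I x) {x : G}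
    (hY : ContMDiffAt I I.tangent ∞ (T% Y) x) :
    leftField (fun q ↦ leviCivita I G Y q (X q)) =ᶠ[nhds x] fun q ↦
      mvfderiv I (leftField Y) q (X q) + gConnL I G (leftField X q) (leftField Y q) := by
  filter_upwards [ContMDiffAt.eventually_mdifferentiableAt_section hY] with q hq
  exact hinv.leftToId_leviCivita hq (X q)

theorem IsLeftInvariantMetric.contMDiffAt_leftField_leviCivita (hinv : IsLeftInvariantMetric I G)
    {X Y : Π x : G, TangentSpace I x} {x : G} (hX : ContMDiffAt I I.tangent ∞ (T% X) x)
    (hY : ContMDiffAt I I.tangent ∞ (T% Y) x) :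
    ContMDiffAt I 𝓘(ℝ, TangentSpace I (1 : G)) ∞
      (leftField (fun q ↦ leviCivita I G Y q (X q))) x := by
  refine ContMDiffAt.congr_of_eventuallyEq ?_ (hinv.leftField_leviCivita_eventuallyEq X hY)
  exact (contMDiffAt_mvfderiv_apply (hinv.contMDiffAt_leftField hY) hX).add
    (contMDiffAt_bilinear _ (hinv.contMDiffAt_leftField hX) (hinv.contMDiffAt_leftField hY))

theorem IsLeftInvariantMetric.leftToId_leviCivita_leviCivita (hinv : IsLeftInvariantMetric I G)
    {X Y Z : Π x : G, TangentSpace I x} {x : G} (hY : ContMDiffAt I I.tangent ∞ (T% Y) x)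
    (hZ : ContMDiffAt I I.tangent ∞ (T% Z) x) :
    leftToId I x (leviCivita I G (fun q ↦ leviCivita I G Z q (Y q)) x (X x)) =
      mvfderiv I (fun q ↦ mvfderiv I (leftField Z) q (Y q)) x (X x)
      + (gConnL I G (mvfderiv I (leftField Y) x (X x)) (leftField Z x)
        + gConnL I G (leftField Y x) (mvfderiv I (leftField Z) x (X x)))
      + gConnL I G (leftField X x) (mvfderiv I (leftField Z) x (Y x)
        + gConnL I G (leftField Y x) (leftField Z x)) := by
  have hy := hinv.contMDiffAt_leftField hY
  have hz := hinv.contMDiffAt_leftField hZ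
  have hev := hinv.leftField_leviCivita_eventuallyEq Y hZ
  rw [hinv.leftToId_leviCivita (mdifferentiableAt_of_leftField
    ((hinv.contMDiffAt_leftField_leviCivita hY hZ).mdifferentiableAt (by simp))),
    hev.mvfderiv_eq, hev.self_of_nhds]
  have h := mvfderiv_add (I := I)
    ((contMDiffAt_mvfderiv_apply hz hY).mdifferentiableAt (by simp))
    (mdifferentiableAt_bilinear (gConnL I G) (hy.mdifferentiableAt (by simp))
      (hz.mdifferentiableAt (by simp)))
  have h' := congrArg (fun A ↦ A (X x)) h
  refine congrArg₂ (· + ·) (h'.trans ?_) rfl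
  rw [_root_.add_apply, mvfderiv_bilinear (gConnL I G) (hy.mdifferentiableAt (by simp))
      (hz.mdifferentiableAt (by simp))]

variable (I G) in
/-- The curvature of the `𝔤`-connection, as a continuous trilinear map. -/
def gCurvL : TangentSpace I (1 : G) →L[ℝ] TangentSpace I (1 : G) →L[ℝ] TangentSpace I (1 : G) →L[ℝ]
    TangentSpace I (1 : G) :=
  LinearMap.toContinuousBilinearMap
    (LinearMap.mk₂ ℝ (fun x y ↦ gConnL I G x ∘L gConnL I G y - gConnL I G y ∘L gConnL I G x
      - gConnL I G (gConnL I G x y - gConnL I G y x))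
      (fun _ _ _ ↦ by ext; simp [-gConnL_apply]; abel) (fun _ _ _ ↦ by ext; simp [smul_sub])
      (fun _ _ _ ↦ by ext; simp [-gConnL_apply]; abel) (fun _ _ _ ↦ by ext; simp [smul_sub]))

theorem gCurvL_apply (x y z : TangentSpace I (1 : G)) : gCurvL I G x y z =
    gConnL I G x (gConnL I G y z) - gConnL I G y (gConnL I G x z)
      - gConnL I G (gConnL I G x y - gConnL I G y x) z := rfl

theorem gCurvL_add_left (x x' y z : TangentSpace I (1 : G)) :
    gCurvL I G (x + x') y z = gCurvL I G x y z + gCurvL I G x' y z :=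
  congrArg (fun A : TangentSpace I (1 : G) →L[ℝ] TangentSpace I (1 : G) →L[ℝ]
    TangentSpace I (1 : G) ↦ A y z) (ContinuousLinearMap.map_add (gCurvL I G) x x')

theorem gCurvL_add_mid (x y y' z : TangentSpace I (1 : G)) :
    gCurvL I G x (y + y') z = gCurvL I G x y z + gCurvL I G x y' z := by
  rw [map_add]; rfl

theorem gCurvL_add_right (x y z z' : TangentSpace I (1 : G)) :
    gCurvL I G x y (z + z') = gCurvL I G x y z + gCurvL I G x y z' :=
  map_add _ _ _

theorem IsLeftInvariantMetric.leftToId_curvatureField (hinv : IsLeftInvariantMetric I G)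
    {X Y Z : Π x : G, TangentSpace I x} {x : G} (hX : ContMDiffAt I I.tangent ∞ (T% X) x)
    (hY : ContMDiffAt I I.tangent ∞ (T% Y) x) (hZ : ContMDiffAt I I.tangent ∞ (T% Z) x) :
    leftToId I x (curvatureField (leviCivita I G) X Y Z x) =
      gCurvL I G (leftField X x) (leftField Y x) (leftField Z x) := by
  have hX' := hX.mdifferentiableAt (by simp : (∞ : ℕ∞ω) ≠ 0)
  have hY' := hY.mdifferentiableAt (by simp : (∞ : ℕ∞ω) ≠ 0)
  have hZ' := hZ.mdifferentiableAt (by simp : (∞ : ℕ∞ω) ≠ 0)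
  have hbr : leftToId I x (VectorField.mlieBracket I X Y x) =
      mvfderiv I (leftField Y) x (X x) + gConnL I G (leftField X x) (leftField Y x)
      - (mvfderiv I (leftField X) x (Y x) + gConnL I G (leftField Y x) (leftField X x)) := by
    rw [← leviCivita_torsionFree hX' hY', leftToId_sub, hinv.leftToId_leviCivita hY',
      hinv.leftToId_leviCivita hX']
    rfl
  rw [curvatureField, leftToId_sub, leftToId_sub, hinv.leftToId_leviCivita_leviCivita hY hZ,
    hinv.leftToId_leviCivita_leviCivita hX hZ, hinv.leftToId_leviCivita hZ', hbr,
    ← mvfderiv_mlieBracket_vector (hinv.contMDiffAt_leftField hZ) hX hY, ← gConnL_apply,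
    gCurvL_apply]
  simp only [map_add, map_sub, _root_.add_apply, _root_.sub_apply]
  abel

/-- The curvature in the left trivialization. -/
theorem IsLeftInvariantMetric.leftToId_curvature (hinv : IsLeftInvariantMetric I G) (x : G)
    (u v w : TangentSpace I x) :
    leftToId I x (curvature (leviCivita I G) x u v w) =
      gCurvL I G (leftToId I x u) (leftToId I x v) (leftToId I x w) := by
  rw [curvature, hinv.leftToId_curvatureField (FiberBundle.contMDiffAt_extend I E u)
    (FiberBundle.contMDiffAt_extend I E v) (FiberBundle.contMDiffAt_extend I E w)]
  simp only [leftField, FiberBundle.extend_apply_self]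

theorem IsLeftInvariantMetric.gCurv_eq (hinv : IsLeftInvariantMetric I G)
    (x y z : TangentSpace I (1 : G)) : gCurv I x y z = gCurvL I G x y z := by
  have h := hinv.leftToId_curvature 1 x y z
  simp only [leftToId_one] at h
  exact h

/-- The covariant derivative of the curvature in the left trivialization. -/
theorem IsLeftInvariantMetric.leftToId_covCurvature (hinv : IsLeftInvariantMetric I G) (x : G)
    (u v w z : TangentSpace I x) :
    leftToId I x (covCurvature (leviCivita I G) x u v w z) =
      gAct I (leftToId I x u) (gCurv I) (leftToId I x v) (leftToId I x w) (leftToId I x z) := by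
  have hd : ∀ a : TangentSpace I x, MDiffAt (T% (FiberBundle.extend E a)) x :=
    fun a ↦ FiberBundle.mdifferentiableAt_extend I E a
  have hl : ∀ a : TangentSpace I x, MDifferentiableAt I 𝓘(ℝ, TangentSpace I (1 : G))
      (leftField (FiberBundle.extend E a)) x := fun a ↦ hinv.mdifferentiableAt_leftField (hd a)
  set R : Π y : G, TangentSpace I y := fun y ↦ curvature (leviCivita I G) y
    (FiberBundle.extend E v y) (FiberBundle.extend E w y) (FiberBundle.extend E z y) with hR
  have eR : leftField R = fun y ↦ gCurvL I G (leftField (FiberBundle.extend E v) y)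
      (leftField (FiberBundle.extend E w) y) (leftField (FiberBundle.extend E z) y) := by
    funext y; exact hinv.leftToId_curvature y _ _ _
  have hRd : MDiffAt (T% R) x := by
    refine mdifferentiableAt_of_leftField ?_
    rw [eR]
    exact mdifferentiableAt_trilinear (gCurvL I G) (hl v) (hl w) (hl z)
  rw [covCurvature, covCurvatureField, leftToId_sub, leftToId_sub, leftToId_sub,
    hinv.leftToId_leviCivita hRd, eR, mvfderiv_trilinear _ (hl v) (hl w) (hl z)]
  simp only [hinv.leftToId_curvature, hinv.leftToId_leviCivita (hd _), gAct, hinv.gCurv_eq,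
    leftField, FiberBundle.extend_apply_self, gCurvL_add_left, gCurvL_add_mid, gCurvL_add_right]
  abel

end CurvatureTrivialization

section Multilinear

variable {V : Type*} [NormedAddCommGroup V] [NormedSpace ℝ V]

section

variable (B : V →L[ℝ] V →L[ℝ] V) (T : V →L[ℝ] V →L[ℝ] V →L[ℝ] V) (c : ℝ) (x x' y y' z z' : V)

theorem clm₂_add_left : B (x + x') y = B x y + B x' y :=
  congrArg (fun A : V →L[ℝ] V ↦ A y) (ContinuousLinearMap.map_add B x x')

theorem clm₂_add_right : B x (y + y') = B x y + B x y' :=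
  ContinuousLinearMap.map_add (B x) y y'

theorem clm₂_smul_left : B (c • x) y = c • B x y :=
  congrArg (fun A : V →L[ℝ] V ↦ A y) (ContinuousLinearMap.map_smul B c x)

theorem clm₂_smul_right : B x (c • y) = c • B x y :=
  ContinuousLinearMap.map_smul (B x) c y

theorem clm₃_add_left : T (x + x') y z = T x y z + T x' y z :=
  congrArg (fun A : V →L[ℝ] V →L[ℝ] V ↦ A y z) (ContinuousLinearMap.map_add T x x')

theorem clm₃_smul_left : T (c • x) y z = c • T x y z :=
  congrArg (fun A : V →L[ℝ] V →L[ℝ] V ↦ A y z) (ContinuousLinearMap.map_smul T c x)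

end

/-- The derivation action of the bilinear operation `B` on a trilinear operation `T`. -/
def derivationAct (B : V →L[ℝ] V →L[ℝ] V) (T : V →L[ℝ] V →L[ℝ] V →L[ℝ] V) (w x y z : V) : V :=
  B w (T x y z) - T (B w x) y z - T x (B w y) z - T x y (B w z)

section

variable (B : V →L[ℝ] V →L[ℝ] V) (T : V →L[ℝ] V →L[ℝ] V →L[ℝ] V) (w w' x x' y y' z z' : V)

theorem derivationAct_add₀ :
    derivationAct B T (w + w') x y z = derivationAct B T w x y z + derivationAct B T w' x y z := by
  simp only [derivationAct, clm₂_add_left, clm₂_add_right, clm₃_add_left]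
  abel

theorem derivationAct_add₁ :
    derivationAct B T w (x + x') y z = derivationAct B T w x y z + derivationAct B T w x' y z := by
  simp only [derivationAct, clm₂_add_right, clm₃_add_left]
  abel

theorem derivationAct_add₂ :
    derivationAct B T w x (y + y') z = derivationAct B T w x y z + derivationAct B T w x y' z := by
  simp only [derivationAct, clm₂_add_left, clm₂_add_right]
  abel

theorem derivationAct_add₃ :
    derivationAct B T w x y (z + z') = derivationAct B T w x y z + derivationAct B T w x y z' := by
  simp only [derivationAct, clm₂_add_right]
  abel

theorem derivationAct_smul₀ (c : ℝ) :
    derivationAct B T (c • w) x y z = c • derivationAct B T w x y z := by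
  simp only [derivationAct, clm₂_smul_left, clm₂_smul_right, clm₃_smul_left, smul_sub]

theorem derivationAct_smul₁ (c : ℝ) :
    derivationAct B T w (c • x) y z = c • derivationAct B T w x y z := by
  simp only [derivationAct, clm₂_smul_right, clm₃_smul_left, smul_sub]

end

theorem _root_.HasDerivWithinAt.bilinear {V W Z : Type*} [NormedAddCommGroup V] [NormedSpace ℝ V]
    [NormedAddCommGroup W] [NormedSpace ℝ W] [NormedAddCommGroup Z] [NormedSpace ℝ Z]
    (B : V →L[ℝ] W →L[ℝ] Z) {s : Set ℝ} {t : ℝ} {f : ℝ → V} {g : ℝ → W} {f' : V} {g' : W}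
    (hf : HasDerivWithinAt f f' s t) (hg : HasDerivWithinAt g g' s t) :
    HasDerivWithinAt (fun τ ↦ B (f τ) (g τ)) (B f' (g t) + B (f t) g') s t :=
  (B.hasFDerivAt.comp_hasDerivWithinAt t hf).clm_apply hg

theorem _root_.HasDerivWithinAt.trilinear (T : V →L[ℝ] V →L[ℝ] V →L[ℝ] V) {s : Set ℝ} {t : ℝ}
    {x y z : ℝ → V} {x' y' z' : V} (hx : HasDerivWithinAt x x' s t)
    (hy : HasDerivWithinAt y y' s t) (hz : HasDerivWithinAt z z' s t) :
    HasDerivWithinAt (fun τ ↦ T (x τ) (y τ) (z τ))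
      (T x' (y t) (z t) + T (x t) y' (z t) + T (x t) (y t) z') s t :=
  (hx.bilinear T hy).clm_apply hz

theorem hasDerivWithinAt_derivationAct (B : V →L[ℝ] V →L[ℝ] V) (T : V →L[ℝ] V →L[ℝ] V →L[ℝ] V)
    {s : Set ℝ} {t : ℝ} {w x y z : ℝ → V} {w' x' y' z' : V} (hw : HasDerivWithinAt w w' s t)
    (hx : HasDerivWithinAt x x' s t) (hy : HasDerivWithinAt y y' s t)
    (hz : HasDerivWithinAt z z' s t) :
    HasDerivWithinAt (fun τ ↦ derivationAct B T (w τ) (x τ) (y τ) (z τ))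
      (derivationAct B T w' (x t) (y t) (z t) + derivationAct B T (w t) x' (y t) (z t)
        + derivationAct B T (w t) (x t) y' (z t) + derivationAct B T (w t) (x t) (y t) z') s t := by
  have h := (((hw.bilinear B (hx.trilinear T hy hz)).sub
    ((hw.bilinear B hx).trilinear T hy hz)).sub (hx.trilinear T (hw.bilinear B hy) hz)).sub
    (hx.trilinear T hy (hw.bilinear B hz))
  refine h.congr_deriv ?_
  simp only [derivationAct, clm₂_add_left, clm₂_add_right, clm₃_add_left]
  abel

theorem contDiffOn_bilinear {V W Z : Type*} [NormedAddCommGroup V] [NormedSpace ℝ V]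
    [NormedAddCommGroup W] [NormedSpace ℝ W] [NormedAddCommGroup Z] [NormedSpace ℝ Z]
    (B : V →L[ℝ] W →L[ℝ] Z) {s : Set ℝ} {x : ℝ → V} {y : ℝ → W}
    (hx : ContDiffOn ℝ ∞ x s) (hy : ContDiffOn ℝ ∞ y s) :
    ContDiffOn ℝ ∞ (fun τ ↦ B (x τ) (y τ)) s :=
  (B.contDiff.comp_contDiffOn hx).clm_apply hy

theorem contDiffOn_trilinear (T : V →L[ℝ] V →L[ℝ] V →L[ℝ] V) {s : Set ℝ} {x y z : ℝ → V}
    (hx : ContDiffOn ℝ ∞ x s) (hy : ContDiffOn ℝ ∞ y s) (hz : ContDiffOn ℝ ∞ z s) :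
    ContDiffOn ℝ ∞ (fun τ ↦ T (x τ) (y τ) (z τ)) s :=
  (contDiffOn_bilinear T hx hy).clm_apply hz

theorem contDiffOn_derivationAct (B : V →L[ℝ] V →L[ℝ] V) (T : V →L[ℝ] V →L[ℝ] V →L[ℝ] V)
    {s : Set ℝ} {w x y z : ℝ → V} (hw : ContDiffOn ℝ ∞ w s) (hx : ContDiffOn ℝ ∞ x s)
    (hy : ContDiffOn ℝ ∞ y s) (hz : ContDiffOn ℝ ∞ z s) :
    ContDiffOn ℝ ∞ (fun τ ↦ derivationAct B T (w τ) (x τ) (y τ) (z τ)) s :=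
  (((contDiffOn_bilinear B hw (contDiffOn_trilinear T hx hy hz)).sub
    (contDiffOn_trilinear T (contDiffOn_bilinear B hw hx) hy hz)).sub
    (contDiffOn_trilinear T hx (contDiffOn_bilinear B hw hy) hz)).sub
    (contDiffOn_trilinear T hx hy (contDiffOn_bilinear B hw hz))

/-- The expression `𝓕` for a bilinear operation `B` and a trilinear operation `T`. -/
def reducedF (B : V →L[ℝ] V →L[ℝ] V) (T : V →L[ℝ] V →L[ℝ] V →L[ℝ] V)
    (x₀ x₁ x₂ y₀ y₁ y₂ : V) : V :=
  let A := derivationAct B T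
  let A2 := fun x y z ↦
    B y₀ (A y₀ x y z) - A y₀ (B y₀ x) y z - A y₀ x (B y₀ y) z - A y₀ x y (B y₀ z)
  (A (y₁ - B y₀ y₀) x₀ y₀ y₀ + A2 x₀ y₀ y₀) + A x₀ y₁ y₀ y₀ + T (T x₀ y₀ y₀) y₀ y₀
    + T x₀ y₂ y₀ + 4 • T x₁ y₀ y₁
    + 2 • (A y₀ x₁ y₀ y₀ + A y₀ x₀ y₁ y₀ + T x₂ y₀ y₀)
    + 3 • (A y₀ x₀ y₀ y₁ + T x₀ y₀ y₂ + T x₀ y₁ y₁)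

theorem isLinearMap_reducedF (B : V →L[ℝ] V →L[ℝ] V) (T : V →L[ℝ] V →L[ℝ] V →L[ℝ] V)
    (y₀ y₁ y₂ : V) :
    IsLinearMap ℝ fun x : V × V × V ↦ reducedF B T x.1 x.2.1 x.2.2 y₀ y₁ y₂ where
  map_add x x' := by
    simp only [reducedF, Prod.fst_add, Prod.snd_add, derivationAct_add₀, derivationAct_add₁,
      clm₂_add_right, clm₃_add_left]
    abel
  map_smul c x := by
    simp only [reducedF, Prod.smul_fst, Prod.smul_snd, derivationAct_smul₀, derivationAct_smul₁,
      clm₂_smul_right, clm₃_smul_left]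
    module

theorem contDiff_bilinear {V W Z U : Type*} [NormedAddCommGroup V] [NormedSpace ℝ V]
    [NormedAddCommGroup W] [NormedSpace ℝ W] [NormedAddCommGroup Z] [NormedSpace ℝ Z]
    [NormedAddCommGroup U] [NormedSpace ℝ U]
    (B : V →L[ℝ] W →L[ℝ] Z) {x : U → V} {y : U → W} (hx : ContDiff ℝ ∞ x) (hy : ContDiff ℝ ∞ y) :
    ContDiff ℝ ∞ (fun τ ↦ B (x τ) (y τ)) :=
  (B.contDiff.comp hx).clm_apply hy

theorem contDiff_trilinear {W : Type*} [NormedAddCommGroup W] [NormedSpace ℝ W]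
    (T : V →L[ℝ] V →L[ℝ] V →L[ℝ] V) {x y z : W → V}
    (hx : ContDiff ℝ ∞ x) (hy : ContDiff ℝ ∞ y) (hz : ContDiff ℝ ∞ z) :
    ContDiff ℝ ∞ (fun τ ↦ T (x τ) (y τ) (z τ)) :=
  (contDiff_bilinear T hx hy).clm_apply hz

theorem contDiff_reducedF (B : V →L[ℝ] V →L[ℝ] V) (T : V →L[ℝ] V →L[ℝ] V →L[ℝ] V) :
    ContDiff ℝ ∞ fun x : V × V × V × V × V × V ↦
      reducedF B T x.1 x.2.1 x.2.2.1 x.2.2.2.1 x.2.2.2.2.1 x.2.2.2.2.2 := by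
  have hA : ∀ {w x y z : V × V × V × V × V × V → V}, ContDiff ℝ ∞ w → ContDiff ℝ ∞ x →
      ContDiff ℝ ∞ y → ContDiff ℝ ∞ z →
      ContDiff ℝ ∞ fun τ ↦ derivationAct B T (w τ) (x τ) (y τ) (z τ) := fun hw hx hy hz ↦
    (((contDiff_bilinear B hw (contDiff_trilinear T hx hy hz)).sub
    (contDiff_trilinear T (contDiff_bilinear B hw hx) hy hz)).sub
    (contDiff_trilinear T hx (contDiff_bilinear B hw hy) hz)).sub
    (contDiff_trilinear T hx hy (contDiff_bilinear B hw hz))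
  have hB := fun {x y : V × V × V × V × V × V → V} ↦ contDiff_bilinear B (x := x) (y := y)
  have hT := fun {x y z : V × V × V × V × V × V → V} ↦
    contDiff_trilinear T (x := x) (y := y) (z := z)
  have h₀ : ContDiff ℝ ∞ fun x : V × V × V × V × V × V ↦ x.1 := by fun_prop
  have h₁ : ContDiff ℝ ∞ fun x : V × V × V × V × V × V ↦ x.2.1 := by fun_prop
  have h₂ : ContDiff ℝ ∞ fun x : V × V × V × V × V × V ↦ x.2.2.1 := by fun_prop
  have k₀ : ContDiff ℝ ∞ fun x : V × V × V × V × V × V ↦ x.2.2.2.1 := by fun_prop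
  have k₁ : ContDiff ℝ ∞ fun x : V × V × V × V × V × V ↦ x.2.2.2.2.1 := by fun_prop
  have k₂ : ContDiff ℝ ∞ fun x : V × V × V × V × V × V ↦ x.2.2.2.2.2 := by fun_prop
  have hA2 : ContDiff ℝ ∞ fun x : V × V × V × V × V × V ↦
      B x.2.2.2.1 (derivationAct B T x.2.2.2.1 x.1 x.2.2.2.1 x.2.2.2.1)
      - derivationAct B T x.2.2.2.1 (B x.2.2.2.1 x.1) x.2.2.2.1 x.2.2.2.1
      - derivationAct B T x.2.2.2.1 x.1 (B x.2.2.2.1 x.2.2.2.1) x.2.2.2.1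
      - derivationAct B T x.2.2.2.1 x.1 x.2.2.2.1 (B x.2.2.2.1 x.2.2.2.1) :=
    (((hB k₀ (hA k₀ h₀ k₀ k₀)).sub (hA k₀ (hB k₀ h₀) k₀ k₀)).sub (hA k₀ h₀ (hB k₀ k₀) k₀)).sub
      (hA k₀ h₀ k₀ (hB k₀ k₀))
  exact (((((((hA (k₁.sub (hB k₀ k₀)) h₀ k₀ k₀).add hA2).add (hA h₀ k₁ k₀ k₀)).add
    (hT (hT h₀ k₀ k₀) k₀ k₀)).add (hT h₀ k₂ k₀)).add ((hT h₁ k₀ k₁).const_smul 4)).add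
    ((((hA k₀ h₁ k₀ k₀).add (hA k₀ h₀ k₁ k₀)).add (hT h₂ k₀ k₀)).const_smul 2)).add
    ((((hA k₀ h₀ k₀ k₁).add (hT h₀ k₀ k₂)).add (hT h₀ k₁ k₁)).const_smul 3)

end Multilinear

section Reduced

variable {E : Type*} [NormedAddCommGroup E] [NormedSpace ℝ E] [FiniteDimensional ℝ E]
  {H : Type*} [TopologicalSpace H] {I : ModelWithCorners ℝ E H}
  {G : Type*} [TopologicalSpace G] [ChartedSpace H G] [Group G] [LieGroup I ∞ G]
  [RiemannianBundle (fun x : G ↦ TangentSpace I x)]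
  [IsContMDiffRiemannianBundle I ∞ E (fun x : G ↦ TangentSpace I x)]

theorem IsLeftInvariantMetric.gAct_eq (hinv : IsLeftInvariantMetric I G)
    (w x y z : TangentSpace I (1 : G)) :
    gAct I w (gCurv I) x y z = derivationAct (gConnL I G) (gCurvL I G) w x y z := by
  simp only [gAct, hinv.gCurv_eq]; rfl

theorem IsLeftInvariantMetric.gF_eq (hinv : IsLeftInvariantMetric I G)
    (x₀ x₁ x₂ y₀ y₁ y₂ : TangentSpace I (1 : G)) :
    gF I x₀ x₁ x₂ y₀ y₁ y₂ = reducedF (gConnL I G) (gCurvL I G) x₀ x₁ x₂ y₀ y₁ y₂ := by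
  have e : gCurv I = fun x y z : TangentSpace I (1 : G) ↦ gCurvL I G x y z := by
    funext x y z; exact hinv.gCurv_eq x y z
  simp only [gF, e]
  rfl

end Reduced

section AlongCurves

variable {E : Type*} [NormedAddCommGroup E] [NormedSpace ℝ E] [FiniteDimensional ℝ E]
  {H : Type*} [TopologicalSpace H] {I : ModelWithCorners ℝ E H}
  {G : Type*} [TopologicalSpace G] [ChartedSpace H G]

theorem hasDerivWithinAt_comp_curve {V : Type*} [NormedAddCommGroup V] [NormedSpace ℝ V]
    {f : G → V} {γ : ℝ → G} {s : Set ℝ} {t : ℝ} (hf : MDifferentiableAt I 𝓘(ℝ, V) f (γ t))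
    (hγ : MDifferentiableWithinAt 𝓘(ℝ, ℝ) I γ s t) :
    HasDerivWithinAt (fun τ ↦ f (γ τ)) (mvfderiv I f (γ t) (velocity I γ s t)) s t := by
  have h := hf.hasMFDerivAt.comp_hasMFDerivWithinAt t hγ.hasMFDerivWithinAt
  have h' : HasFDerivWithinAt (fun τ ↦ f (γ τ))
      (show ℝ →L[ℝ] V from mvfderiv I f (γ t) ∘L mfderivWithin 𝓘(ℝ, ℝ) I γ s t) s t :=
    hasMFDerivWithinAt_iff_hasFDerivWithinAt.1 h
  exact h'.hasDerivWithinAt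

variable [IsManifold I ∞ G]

theorem smoothAlong_velocity {γ : ℝ → G} {s : Set ℝ} (hs : UniqueDiffOn ℝ s)
    (hγ : ContMDiffOn 𝓘(ℝ, ℝ) I ∞ γ s) : SmoothAlong s (velocity I γ s) := by
  have h := hγ.contMDiffOn_tangentMapWithin (m := ∞) (by simp) hs.uniqueMDiffOn
  have h1 : ContMDiff 𝓘(ℝ, ℝ) 𝓘(ℝ, ℝ).tangent ∞
      (fun t : ℝ ↦ (⟨t, (1 : ℝ)⟩ : TangentBundle 𝓘(ℝ, ℝ) ℝ)) := by
    intro t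
    refine contMDiffAt_totalSpace.2 ⟨contMDiffAt_id, ?_⟩
    simpa using contMDiffAt_const
  exact h.comp h1.contMDiffOn fun t ht ↦ ht

end AlongCurves

section LeftAlong

variable {E : Type*} [NormedAddCommGroup E] [NormedSpace ℝ E] [FiniteDimensional ℝ E]
  {H : Type*} [TopologicalSpace H] {I : ModelWithCorners ℝ E H}
  {G : Type*} [TopologicalSpace G] [ChartedSpace H G] [Group G] [LieGroup I ∞ G]
  [RiemannianBundle (fun x : G ↦ TangentSpace I x)]
  [IsContMDiffRiemannianBundle I ∞ E (fun x : G ↦ TangentSpace I x)]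
  {g : ℝ → G} {s : Set ℝ}

/-- The left trivialization of a vector field along a curve. -/
def leftAlong (X : FieldAlong I g) (t : ℝ) : TangentSpace I (1 : G) :=
  leftToId I (g t) (X t)

theorem IsLeftInvariantMetric.smoothAlong_iff (hinv : IsLeftInvariantMetric I G)
    (hg : ContMDiffOn 𝓘(ℝ, ℝ) I ∞ g s) (X : FieldAlong I g) :
    SmoothAlong s X ↔ ContDiffOn ℝ ∞ (leftAlong X) s := by
  constructor
  · exact fun hX ↦ contMDiffOn_iff_contDiffOn.1 fun t ht ↦
      hinv.contMDiffWithinAt_leftToId (hX t ht)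
  · intro hX t ht
    have h := contMDiffWithinAt_mulInvariantVectorField_along (I := I) (hg t ht)
      (contMDiffOn_iff_contDiffOn.2 hX t ht)
    simpa only [leftAlong, mulInvariantVectorField_leftToId] using h

/-- The covariant derivative along a curve in the left trivialization. -/
theorem IsLeftInvariantMetric.leftToId_covAlong (hinv : IsLeftInvariantMetric I G)
    {X : FieldAlong I g} {t : ℝ} (hs : UniqueDiffWithinAt ℝ s t) (ht : t ∈ s)
    (hX : MDifferentiableWithinAt 𝓘(ℝ, ℝ) I.tangent
      (fun τ ↦ (⟨g τ, X τ⟩ : TangentBundle I G)) s t) :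
    leftToId I (g t) (covAlong (leviCivita I G) s X t) = derivWithin (leftAlong X) s t
      + gConn I (leftToId I (g t) (velocity I g s t)) (leftAlong X t) := by
  obtain ⟨hg, hc⟩ := (mdifferentiableWithinAt_totalSpace ..).1 hX
  simp only at hg hc
  set tr := trivializationAt E (fun x : G ↦ TangentSpace I x) (g t) with htr
  have hmem : g t ∈ tr.baseSet := FiberBundle.mem_baseSet_trivializationAt' _
  have hnear : ∀ᶠ q in nhds (g t), q ∈ tr.baseSet := tr.open_baseSet.mem_nhds hmem
  set c : ℝ → E := fun τ ↦ (tr ⟨g τ, X τ⟩).2 with hcdef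
  have hc' : HasDerivWithinAt c (derivWithin c s t) s t :=
    (mdifferentiableWithinAt_iff_differentiableWithinAt.1 hc).hasDerivWithinAt
  let e := Module.finBasis ℝ E
  let F : Fin (Module.finrank ℝ E) → Π x : G, TangentSpace I x := fun j ↦
    FiberBundle.extend E (tr.symm (g t) (e j))
  have hF : ∀ j q, F j q = tr.symm q (e j) := by
    intro j q
    simp only [F, FiberBundle.extend, ← htr, tr.apply_mk_symm hmem]
  have hFd : ∀ j, MDifferentiableAt I 𝓘(ℝ, TangentSpace I (1 : G)) (leftField (F j)) (g t) :=
    fun j ↦ hinv.mdifferentiableAt_leftField (FiberBundle.mdifferentiableAt_extend I E _)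
  have hsymm : ∀ q ∈ tr.baseSet, ∀ v : E,
      leftToId I q (tr.symm q v) = ∑ j, e.repr v j • leftField (F j) q := by
    intro q hq v
    have h1 : ∀ w, tr.symmₗ ℝ q w = tr.symm q w := fun w ↦ tr.symmₗ_apply hq w
    have h2 : tr.symm q v = ∑ j, e.repr v j • tr.symm q (e j) := by
      have h3 := congrArg (tr.symmₗ ℝ q) (e.sum_repr v)
      rw [map_sum, h1] at h3
      simp only [map_smul] at h3
      simp only [h1] at h3
      exact h3.symm
    rw [h2, ← leftToIdL_apply, map_sum]
    simp only [map_smul, leftField, hF, leftToIdL_apply]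
  have hχ : leftAlong X =ᶠ[nhdsWithin t s] fun τ ↦ ∑ j, e.repr (c τ) j • leftField (F j) (g τ) := by
    filter_upwards [hg.continuousWithinAt.eventually hnear] with τ hτ
    rw [← hsymm _ hτ]
    simp only [leftAlong, c]
    rw [tr.symm_apply_apply_mk hτ]
  have hcj : ∀ j, HasDerivWithinAt (fun τ ↦ e.repr (c τ) j) (e.repr (derivWithin c s t) j) s t :=
    fun j ↦ (LinearMap.toContinuousLinearMap (e.coord j)).hasFDerivAt.comp_hasDerivWithinAt t hc'
  have hχ' : HasDerivWithinAt (leftAlong X)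
      (∑ j, (e.repr (c t) j • mvfderiv I (leftField (F j)) (g t) (velocity I g s t)
        + e.repr (derivWithin c s t) j • leftField (F j) (g t))) s t := by
    refine HasDerivWithinAt.congr_of_eventuallyEq_of_mem ?_ hχ ht
    exact HasDerivWithinAt.fun_sum fun j _ ↦ (hcj j).smul (hasDerivWithinAt_comp_curve (hFd j) hg)
  have hext : leftField (FiberBundle.extend E (X t)) =ᶠ[nhds (g t)]
      fun q ↦ ∑ j, e.repr (c t) j • leftField (F j) q := by
    filter_upwards [hnear] with q hq
    exact hsymm q hq (c t)
  have hextd : HasMFDerivAt I 𝓘(ℝ, TangentSpace I (1 : G))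
      (fun q ↦ ∑ j, e.repr (c t) j • leftField (F j) q) (g t)
      (∑ j, e.repr (c t) j • mvfderiv I (leftField (F j)) (g t)) := by
    rw [← Finset.sum_fn]
    exact HasMFDerivAt.sum (f := fun j q ↦ e.repr (c t) j • leftField (F j) q)
      (f' := fun j ↦ e.repr (c t) j • mvfderiv I (leftField (F j)) (g t))
      fun j _ ↦ (hFd j).hasMFDerivAt.const_smul _
  have hextd' : mvfderiv I (fun q ↦ ∑ j, e.repr (c t) j • leftField (F j) q) (g t) =
      ∑ j, e.repr (c t) j • mvfderiv I (leftField (F j)) (g t) := hextd.mfderiv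
  rw [hχ'.derivWithin hs, covAlong, leftToId_add, hinv.leftToId_leviCivita
    (FiberBundle.mdifferentiableAt_extend I E _), hext.mvfderiv_eq, hextd', hsymm _ hmem]
  simp only [leftField, FiberBundle.extend_apply_self, _root_.sum_apply, _root_.smul_apply,
    Finset.sum_add_distrib, leftAlong]
  rw [← htr]
  abel

theorem IsLeftInvariantMetric.leftToId_covAlong_of_smooth (hinv : IsLeftInvariantMetric I G)
    (hs : UniqueDiffOn ℝ s) {ξ : ℝ → TangentSpace I (1 : G)}
    (hξ : ∀ t ∈ s, ξ t = leftToId I (g t) (velocity I g s t)) {X : FieldAlong I g}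
    (hX : SmoothAlong s X) {t : ℝ} (ht : t ∈ s) :
    leftAlong (covAlong (leviCivita I G) s X) t = gDeriv I s ξ (leftAlong X) t := by
  rw [gDeriv, hξ t ht]
  exact hinv.leftToId_covAlong (hs t ht) ht ((hX t ht).mdifferentiableWithinAt (by simp))

theorem gDeriv_congr {ξ η η' : ℝ → TangentSpace I (1 : G)} (h : EqOn η η' s) {t : ℝ} (ht : t ∈ s) :
    gDeriv I s ξ η t = gDeriv I s ξ η' t := by
  rw [gDeriv, gDeriv, derivWithin_congr h (h ht), h ht]

theorem contDiffOn_gDeriv (hs : UniqueDiffOn ℝ s) {ξ η : ℝ → TangentSpace I (1 : G)}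
    (hξ : ContDiffOn ℝ ∞ ξ s) (hη : ContDiffOn ℝ ∞ η s) : ContDiffOn ℝ ∞ (gDeriv I s ξ η) s :=
  (hη.derivWithin hs (by simp)).add (contDiffOn_bilinear (gConnL I G) hξ hη)

theorem IsLeftInvariantMetric.smoothAlong_covAlong (hinv : IsLeftInvariantMetric I G)
    (hs : UniqueDiffOn ℝ s) (hg : ContMDiffOn 𝓘(ℝ, ℝ) I ∞ g s) {X : FieldAlong I g}
    (hX : SmoothAlong s X) : SmoothAlong s (covAlong (leviCivita I G) s X) := by
  rw [hinv.smoothAlong_iff hg]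
  refine (contDiffOn_gDeriv (ξ := leftAlong (velocity I g s)) hs
    ((hinv.smoothAlong_iff hg _).1 (smoothAlong_velocity hs hg))
    ((hinv.smoothAlong_iff hg X).1 hX)).congr fun t ht ↦ ?_
  exact hinv.leftToId_covAlong_of_smooth hs (fun _ _ ↦ rfl) hX ht

end LeftAlong

section ReducedForm

variable {E : Type*} [NormedAddCommGroup E] [NormedSpace ℝ E] [FiniteDimensional ℝ E]
  {H : Type*} [TopologicalSpace H] {I : ModelWithCorners ℝ E H}
  {G : Type*} [TopologicalSpace G] [ChartedSpace H G] [Group G] [LieGroup I ∞ G]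
  [RiemannianBundle (fun x : G ↦ TangentSpace I x)]
  [IsContMDiffRiemannianBundle I ∞ E (fun x : G ↦ TangentSpace I x)]
  {g : ℝ → G} {s : Set ℝ} {ξ : ℝ → TangentSpace I (1 : G)}

theorem IsLeftInvariantMetric.leftAlong_curvatureAlong (hinv : IsLeftInvariantMetric I G)
    (X Y Z : FieldAlong I g) (t : ℝ) :
    leftAlong (curvatureAlong (leviCivita I G) g X Y Z) t =
      gCurvL I G (leftAlong X t) (leftAlong Y t) (leftAlong Z t) :=
  hinv.leftToId_curvature _ _ _ _

theorem leftAlong_tensorCovAlong (T : TensorAlong I g) (X Y Z : FieldAlong I g) (t : ℝ) :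
    leftAlong (tensorCovAlong (leviCivita I G) s T X Y Z) t =
      leftAlong (covAlong (leviCivita I G) s (T X Y Z)) t
      - leftAlong (T (covAlong (leviCivita I G) s X) Y Z) t
      - leftAlong (T X (covAlong (leviCivita I G) s Y) Z) t
      - leftAlong (T X Y (covAlong (leviCivita I G) s Z)) t := by
  simp only [leftAlong, tensorCovAlong, Pi.sub_apply, leftToId_sub]

theorem IsLeftInvariantMetric.smoothAlong_curvatureAlong (hinv : IsLeftInvariantMetric I G)
    (hg : ContMDiffOn 𝓘(ℝ, ℝ) I ∞ g s) {X Y Z : FieldAlong I g}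
    (hX : SmoothAlong s X) (hY : SmoothAlong s Y) (hZ : SmoothAlong s Z) :
    SmoothAlong s (curvatureAlong (leviCivita I G) g X Y Z) := by
  rw [hinv.smoothAlong_iff hg] at *
  exact (contDiffOn_trilinear (gCurvL I G) hX hY hZ).congr
    fun t _ ↦ hinv.leftAlong_curvatureAlong X Y Z t

/-- The first covariant derivative of the curvature along a curve in the left trivialization. -/
theorem IsLeftInvariantMetric.leftAlong_covCurvatureAlong (hinv : IsLeftInvariantMetric I G)
    (hs : UniqueDiffOn ℝ s) (hg : ContMDiffOn 𝓘(ℝ, ℝ) I ∞ g s)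
    (hξ : ∀ t ∈ s, ξ t = leftToId I (g t) (velocity I g s t)) {X Y Z : FieldAlong I g}
    (hX : SmoothAlong s X) (hY : SmoothAlong s Y) (hZ : SmoothAlong s Z) {t : ℝ} (ht : t ∈ s) :
    leftAlong (tensorCovAlong (leviCivita I G) s (curvatureAlong (leviCivita I G) g) X Y Z) t =
      derivationAct (gConnL I G) (gCurvL I G) (ξ t) (leftAlong X t) (leftAlong Y t)
        (leftAlong Z t) := by
  have hd : ∀ {W : FieldAlong I g}, SmoothAlong s W →
      HasDerivWithinAt (leftAlong W) (derivWithin (leftAlong W) s t) s t := fun hW ↦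
    (((hinv.smoothAlong_iff hg _).1 hW).differentiableOn (by simp) t ht).hasDerivWithinAt
  have hR := ((hd hX).trilinear (gCurvL I G) (hd hY) (hd hZ)).derivWithin (hs t ht)
  have hR' : leftAlong (curvatureAlong (leviCivita I G) g X Y Z) = fun τ ↦
      gCurvL I G (leftAlong X τ) (leftAlong Y τ) (leftAlong Z τ) :=
    funext fun τ ↦ hinv.leftAlong_curvatureAlong X Y Z τ
  rw [leftAlong_tensorCovAlong, hinv.leftToId_covAlong_of_smooth hs hξ
    (hinv.smoothAlong_curvatureAlong hg hX hY hZ) ht, hR']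
  simp only [hinv.leftAlong_curvatureAlong, hinv.leftToId_covAlong_of_smooth hs hξ hX ht,
    hinv.leftToId_covAlong_of_smooth hs hξ hY ht, hinv.leftToId_covAlong_of_smooth hs hξ hZ ht,
    gDeriv, hR, derivationAct, gCurvL_add_left, gCurvL_add_mid, gCurvL_add_right, gConnL_apply]
  abel

theorem IsLeftInvariantMetric.contDiffOn_velocity (hinv : IsLeftInvariantMetric I G)
    (hs : UniqueDiffOn ℝ s) (hg : ContMDiffOn 𝓘(ℝ, ℝ) I ∞ g s)
    (hξ : ∀ t ∈ s, ξ t = leftToId I (g t) (velocity I g s t)) : ContDiffOn ℝ ∞ ξ s :=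
  ((hinv.smoothAlong_iff hg _).1 (smoothAlong_velocity hs hg)).congr hξ

theorem IsLeftInvariantMetric.smoothAlong_covCurvatureAlong (hinv : IsLeftInvariantMetric I G)
    (hs : UniqueDiffOn ℝ s) (hg : ContMDiffOn 𝓘(ℝ, ℝ) I ∞ g s)
    {X Y Z : FieldAlong I g}
    (hX : SmoothAlong s X) (hY : SmoothAlong s Y) (hZ : SmoothAlong s Z) :
    SmoothAlong s
      (tensorCovAlong (leviCivita I G) s (curvatureAlong (leviCivita I G) g) X Y Z) := by
  have hv := hinv.contDiffOn_velocity (ξ := leftAlong (velocity I g s)) hs hg fun _ _ ↦ rfl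
  have h := fun t ht ↦ hinv.leftAlong_covCurvatureAlong hs hg (t := t)
    (ξ := leftAlong (velocity I g s)) (fun _ _ ↦ rfl) hX hY hZ ht
  rw [hinv.smoothAlong_iff hg] at *
  exact (contDiffOn_derivationAct (gConnL I G) (gCurvL I G) hv hX hY hZ).congr h

/-- The second covariant derivative of the curvature along a curve in the left trivialization. -/
theorem IsLeftInvariantMetric.leftAlong_covCovCurvatureAlong (hinv : IsLeftInvariantMetric I G)
    (hs : UniqueDiffOn ℝ s) (hg : ContMDiffOn 𝓘(ℝ, ℝ) I ∞ g s)
    (hξ : ∀ t ∈ s, ξ t = leftToId I (g t) (velocity I g s t)) {X Y Z : FieldAlong I g}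
    (hX : SmoothAlong s X) (hY : SmoothAlong s Y) (hZ : SmoothAlong s Z) {t : ℝ} (ht : t ∈ s) :
    leftAlong (tensorCovAlong (leviCivita I G) s
      (tensorCovAlong (leviCivita I G) s (curvatureAlong (leviCivita I G) g)) X Y Z) t =
      derivationAct (gConnL I G) (gCurvL I G) (derivWithin ξ s t) (leftAlong X t) (leftAlong Y t)
        (leftAlong Z t)
      + (gConnL I G (ξ t) (derivationAct (gConnL I G) (gCurvL I G) (ξ t) (leftAlong X t)
          (leftAlong Y t) (leftAlong Z t))
        - derivationAct (gConnL I G) (gCurvL I G) (ξ t) (gConnL I G (ξ t) (leftAlong X t))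
          (leftAlong Y t) (leftAlong Z t)
        - derivationAct (gConnL I G) (gCurvL I G) (ξ t) (leftAlong X t)
          (gConnL I G (ξ t) (leftAlong Y t)) (leftAlong Z t)
        - derivationAct (gConnL I G) (gCurvL I G) (ξ t) (leftAlong X t)
          (leftAlong Y t) (gConnL I G (ξ t) (leftAlong Z t))) := by
  have hd : ∀ {W : FieldAlong I g}, SmoothAlong s W →
      HasDerivWithinAt (leftAlong W) (derivWithin (leftAlong W) s t) s t := fun hW ↦
    (((hinv.smoothAlong_iff hg _).1 hW).differentiableOn (by simp) t ht).hasDerivWithinAt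
  have hξd := ((hinv.contDiffOn_velocity hs hg hξ).differentiableOn (by simp) t ht).hasDerivWithinAt
  have hR := (hasDerivWithinAt_derivationAct (gConnL I G) (gCurvL I G) hξd (hd hX) (hd hY)
    (hd hZ)).derivWithin (hs t ht)
  have hR' : EqOn (leftAlong (tensorCovAlong (leviCivita I G) s
      (curvatureAlong (leviCivita I G) g) X Y Z)) (fun τ ↦ derivationAct (gConnL I G) (gCurvL I G)
        (ξ τ) (leftAlong X τ) (leftAlong Y τ) (leftAlong Z τ)) s :=
    fun τ hτ ↦ hinv.leftAlong_covCurvatureAlong hs hg hξ hX hY hZ hτ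
  have cX := hinv.smoothAlong_covAlong hs hg hX
  have cY := hinv.smoothAlong_covAlong hs hg hY
  have cZ := hinv.smoothAlong_covAlong hs hg hZ
  rw [leftAlong_tensorCovAlong, hinv.leftToId_covAlong_of_smooth hs hξ
    (hinv.smoothAlong_covCurvatureAlong hs hg hX hY hZ) ht, gDeriv_congr hR' ht,
    hinv.leftAlong_covCurvatureAlong hs hg hξ cX hY hZ ht,
    hinv.leftAlong_covCurvatureAlong hs hg hξ hX cY hZ ht,
    hinv.leftAlong_covCurvatureAlong hs hg hξ hX hY cZ ht,
    hinv.leftToId_covAlong_of_smooth hs hξ hX ht, hinv.leftToId_covAlong_of_smooth hs hξ hY ht,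
    hinv.leftToId_covAlong_of_smooth hs hξ hZ ht]
  simp only [gDeriv, hR, ← gConnL_apply, derivationAct_add₁, derivationAct_add₂,
    derivationAct_add₃]
  abel

/-- The left trivialization of `F(X, γ')` is `𝓕`. -/
theorem IsLeftInvariantMetric.leftToId_bigF (hinv : IsLeftInvariantMetric I G)
    (hs : UniqueDiffOn ℝ s) (hg : ContMDiffOn 𝓘(ℝ, ℝ) I ∞ g s)
    {ξ₁ ξ₂ : ℝ → TangentSpace I (1 : G)}
    (hξ : ∀ t ∈ s, ξ t = leftToId I (g t) (velocity I g s t))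
    (hξ₁ : ∀ t ∈ s, ξ₁ t = gDeriv I s ξ ξ t) (hξ₂ : ∀ t ∈ s, ξ₂ t = gDeriv I s ξ ξ₁ t)
    {X : FieldAlong I g} (hX : SmoothAlong s X) {t : ℝ} (ht : t ∈ s) :
    leftToId I (g t) (bigF (leviCivita I G) g s X t) =
      gF I (leftAlong X t) (gDeriv I s ξ (leftAlong X) t)
        (gDeriv I s ξ (gDeriv I s ξ (leftAlong X)) t) (ξ t) (ξ₁ t) (ξ₂ t) := by
  have hY := smoothAlong_velocity (I := I) hs hg
  have hDY := hinv.smoothAlong_covAlong hs hg hY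
  have hD2Y := hinv.smoothAlong_covAlong hs hg hDY
  have hDX := hinv.smoothAlong_covAlong hs hg hX
  have eY : EqOn (leftAlong (velocity I g s)) ξ s := fun τ hτ ↦ (hξ τ hτ).symm
  have eDY : EqOn (leftAlong (covAlong (leviCivita I G) s (velocity I g s))) ξ₁ s := fun τ hτ ↦ by
    rw [hinv.leftToId_covAlong_of_smooth hs hξ hY hτ, gDeriv_congr eY hτ, hξ₁ τ hτ]
  have eD2Y : leftAlong (covAlong (leviCivita I G) s (covAlong (leviCivita I G) s
      (velocity I g s))) t = ξ₂ t := by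
    rw [hinv.leftToId_covAlong_of_smooth hs hξ hDY ht, gDeriv_congr eDY ht, hξ₂ t ht]
  have eDX : EqOn (leftAlong (covAlong (leviCivita I G) s X)) (gDeriv I s ξ (leftAlong X)) s :=
    fun τ hτ ↦ hinv.leftToId_covAlong_of_smooth hs hξ hX hτ
  have eD2X : leftAlong (covAlong (leviCivita I G) s (covAlong (leviCivita I G) s X)) t =
      gDeriv I s ξ (gDeriv I s ξ (leftAlong X)) t := by
    rw [hinv.leftToId_covAlong_of_smooth hs hξ hDX ht, gDeriv_congr eDX ht]
  have eξ : derivWithin ξ s t = ξ₁ t - gConnL I G (ξ t) (ξ t) := by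
    rw [hξ₁ t ht, gDeriv, gConnL_apply]; abel
  have hcov := hinv.leftToId_covCurvature (g t) (X t)
    (covAlong (leviCivita I G) s (velocity I g s) t) (velocity I g s t) (velocity I g s t)
  rw [hinv.gAct_eq] at hcov
  have h1 := hinv.leftAlong_covCovCurvatureAlong hs hg hξ hX hY hY ht
  have h2 := hinv.leftAlong_covCurvatureAlong hs hg hξ hDX hY hY ht
  have h3 := hinv.leftAlong_covCurvatureAlong hs hg hξ hX hDY hY ht
  have h4 := hinv.leftAlong_covCurvatureAlong hs hg hξ hX hY hDY ht
  have hR := hinv.leftAlong_curvatureAlong (g := g)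
  rw [eY ht, eξ] at h1
  rw [eY ht, eDX ht] at h2
  rw [eY ht, eDY ht] at h3 h4
  have e1 : leftToId I (g t) (velocity I g s t) = ξ t := (hξ t ht).symm
  have e2 : leftToId I (g t) (covAlong (leviCivita I G) s (velocity I g s) t) = ξ₁ t := eDY ht
  rw [e1, e2] at hcov
  rw [hinv.gF_eq]
  simp only [reducedF]
  rw [← leftToIdL_apply]
  simp only [bigF, Pi.add_apply, Pi.smul_apply, map_add, map_nsmul]
  simp only [leftToIdL_apply]
  change leftAlong _ t + leftToId I (g t) (covCurvature _ _ _ _ _ _) + leftAlong _ t + leftAlong _ t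
    + 4 • leftAlong _ t + 2 • (leftAlong _ t + leftAlong _ t + leftAlong _ t)
    + 3 • (leftAlong _ t + leftAlong _ t + leftAlong _ t) = _
  rw [h1, h2, h3, h4, hcov]
  simp only [hR, eY ht, eDY ht, eD2Y, eDX ht, eD2X]
  rfl

end ReducedForm

section Potential

variable {E : Type*} [NormedAddCommGroup E] [NormedSpace ℝ E] [FiniteDimensional ℝ E]
  {H : Type*} [TopologicalSpace H] {I : ModelWithCorners ℝ E H}
  {G : Type*} [TopologicalSpace G] [ChartedSpace H G] [Group G] [LieGroup I ∞ G]
  [RiemannianBundle (fun x : G ↦ TangentSpace I x)]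
  [IsContMDiffRiemannianBundle I ∞ E (fun x : G ↦ TangentSpace I x)]

theorem inner_grad (f : G → ℝ) (q : G) (w : TangentSpace I q) :
    (inner ℝ (grad I f q) w : ℝ) = mvfderiv I f q w :=
  InnerProductSpace.toDual_symm_apply (𝕜 := ℝ) (E := TangentSpace I q)

theorem mfderiv_mul_left_mulInvariantVectorField (k q : G) (v : TangentSpace I (1 : G)) :
    mfderiv I I (fun x : G ↦ k * x) q (mulInvariantVectorField v q) =
      mulInvariantVectorField v (k * q) := by
  have h := mfderiv_comp_of_eq (I := I) (I' := I) (I'' := I) (f := fun x : G ↦ q * x)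
    (g := fun x : G ↦ k * x) (x := 1) (y := q)
    (mdifferentiableAt_mul_left _ _) (mdifferentiableAt_mul_left _ _) (mul_one q)
  have e : (fun x : G ↦ k * x) ∘ (fun x : G ↦ q * x) = fun x ↦ k * q * x := by
    ext; simp [mul_assoc]
  rw [e] at h
  exact (congrArg (fun A : E →L[ℝ] E ↦ A (mfderiv I I (fun x : G ↦ q * x) 1 v))
    (mfderiv_congr_base _ (mul_one q))).symm.trans (congrArg (fun A ↦ A v) h).symm

theorem mvfderiv_comp_mul_left {V : Type*} [NormedAddCommGroup V] [NormedSpace ℝ V] {f : G → V}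
    {k q : G} (hf : MDifferentiableAt I 𝓘(ℝ, V) f (k * q)) (u : TangentSpace I q) :
    mvfderiv I (fun x ↦ f (k * x)) q u =
      mvfderiv I f (k * q) (mfderiv I I (fun x : G ↦ k * x) q u) := by
  have h := (hf.hasMFDerivAt.comp q (mdifferentiableAt_mul_left k q).hasMFDerivAt).mfderiv
  exact congrArg (fun A : E →L[ℝ] V ↦ A u) h

theorem IsLeftInvariantMetric.leftField_grad (hinv : IsLeftInvariantMetric I G) (f : G → ℝ) :
    leftField (grad I f) = fun q ↦
      ∑ i, mvfderiv I f q (mulInvariantVectorField (lieFrame I G i) q) • lieFrame I G i := by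
  funext q
  rw [leftField, hinv.leftToId_eq_sum]
  simp only [inner_grad]

theorem IsLeftInvariantMetric.contMDiff_leftField_grad (hinv : IsLeftInvariantMetric I G)
    {f : G → ℝ} (hf : ContMDiff I 𝓘(ℝ, ℝ) ∞ f) :
    ContMDiff I 𝓘(ℝ, TangentSpace I (1 : G)) ∞ (leftField (grad I f)) := by
  rw [hinv.leftField_grad]
  intro q
  refine ContMDiffAt.sum fun i _ ↦ ?_
  have h := contMDiffAt_mvfderiv_apply hf.contMDiffAt
    (contMDiff_mulInvariantVectorField_infty (lieFrame I G i) q)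
  exact h.smul contMDiffAt_const

theorem IsLeftInvariantMetric.leftField_grad_comp_mul_left (hinv : IsLeftInvariantMetric I G)
    {f : G → ℝ} (hf : ContMDiff I 𝓘(ℝ, ℝ) ∞ f) (k q : G) :
    leftField (grad I fun p ↦ f (k * p)) q = leftField (grad I f) (k * q) := by
  simp only [hinv.leftField_grad, mvfderiv_comp_mul_left (hf.mdifferentiable (by simp) _),
    mfderiv_mul_left_mulInvariantVectorField]

/-- The Hessian of the potential in the left trivialization. -/
theorem IsLeftInvariantMetric.leftToId_leviCivita_grad (hinv : IsLeftInvariantMetric I G)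
    {V : G → ℝ} (hV : ContMDiff I 𝓘(ℝ, ℝ) ∞ V) {g₀ : G} {Vext : G → G → ℝ}
    (hVext : ∀ q : G, Vext q g₀ = V q) (hVextInv : ∀ k p q : G, Vext (k * p) (k * q) = Vext p q)
    (k : G) (v : TangentSpace I k) :
    leftToId I k (leviCivita I G (grad I V) k v) = gHess I Vext (k⁻¹ * g₀) (leftToId I k v) := by
  have e : (fun p ↦ Vext p (k⁻¹ * g₀)) = fun p ↦ V (k * p) := by
    funext p
    rw [← hVextInv k, mul_inv_cancel_left, hVext]
  have hG := hinv.contMDiff_leftField_grad hV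
  have hd : ∀ q, MDifferentiableAt I 𝓘(ℝ, TangentSpace I (1 : G)) (leftField (grad I V)) q :=
    fun q ↦ hG.mdifferentiable (by simp) q
  have e1 : (fun q : G ↦ leftToId I q (grad I (fun p ↦ V (k * p)) q)) =
      fun q ↦ leftField (grad I V) (k * q) :=
    funext fun q ↦ hinv.leftField_grad_comp_mul_left hV k q
  have e2 : grad I (fun p ↦ V (k * p)) 1 = leftField (grad I V) (k * 1) := by
    rw [← hinv.leftField_grad_comp_mul_left hV, leftField, leftToId_one]
  rw [hinv.leftToId_leviCivita (mdifferentiableAt_of_leftField (hd k)), gHess, e, e1, e2,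
    mvfderiv_comp_mul_left (hd _), mul_one]
  refine congrArg₂ (· + ·) ?_ rfl
  exact congrArg (mvfderiv I (leftField (grad I V)) k) (mulInvariantVectorField_leftToId k v).symm

end Potential

end RiemCubic

end

theorem mainTheorem4 {E : Type*} [NormedAddCommGroup E] [NormedSpace ℝ E] [FiniteDimensional ℝ E]
    {H : Type*} [TopologicalSpace H] (I : ModelWithCorners ℝ E H) [I.Boundaryless]
    {G : Type*} [TopologicalSpace G] [ChartedSpace H G] [Group G] [LieGroup I ∞ G]
    [ConnectedSpace G]
    [RiemannianBundle (fun x : G ↦ TangentSpace I x)]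
    [IsContMDiffRiemannianBundle I ∞ E (fun x : G ↦ TangentSpace I x)]
    (hinv : RiemCubic.IsLeftInvariantMetric I G)
    (V : G → ℝ) (hV : ContMDiff I 𝓘(ℝ, ℝ) ∞ V)
    (g₀ : G) (Vext : G → G → ℝ) (hVext : ∀ q : G, Vext q g₀ = V q)
    (hVextInv : ∀ k p q : G, Vext (k * p) (k * q) = Vext p q)
    (a b : ℝ) (hab : a < b) (g : ℝ → G) (hg : RiemCubic.IsModifiedCubic I V a b g)
    (h : ℝ → G) (hh : ∀ t, h t = (g t)⁻¹ * g₀)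
    (ξ₀ ξ₁ ξ₂ : ℝ → TangentSpace I (1 : G))
    (hξ₀ : ∀ t ∈ Icc a b, ξ₀ t = RiemCubic.leftToId I (g t) (RiemCubic.velocity I g (Icc a b) t))
    (hξ₁ : ∀ t ∈ Icc a b, ξ₁ t = RiemCubic.gDeriv I (Icc a b) ξ₀ ξ₀ t)
    (hξ₂ : ∀ t ∈ Icc a b, ξ₂ t = RiemCubic.gDeriv I (Icc a b) ξ₀ ξ₁ t) :
    (∃ B : TangentSpace I (1 : G) →ₗ[ℝ] TangentSpace I (1 : G) →ₗ[ℝ] TangentSpace I (1 : G),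
      ∀ x y, B x y = RiemCubic.gConn I x y) ∧
    (∃ R : TangentSpace I (1 : G) →ₗ[ℝ] TangentSpace I (1 : G) →ₗ[ℝ] TangentSpace I (1 : G) →ₗ[ℝ]
        TangentSpace I (1 : G),
      ∀ x y z, R x y z = RiemCubic.gCurv I x y z) ∧
    (∀ y₀ y₁ y₂ : TangentSpace I (1 : G),
      IsLinearMap ℝ fun x : TangentSpace I (1 : G) × TangentSpace I (1 : G) × TangentSpace I (1 : G) ↦
        RiemCubic.gF I x.1 x.2.1 x.2.2 y₀ y₁ y₂) ∧
    ContDiff ℝ ∞ (fun x : TangentSpace I (1 : G) × TangentSpace I (1 : G) × TangentSpace I (1 : G) ×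
        TangentSpace I (1 : G) × TangentSpace I (1 : G) × TangentSpace I (1 : G) ↦
      RiemCubic.gF I x.1 x.2.1 x.2.2.1 x.2.2.2.1 x.2.2.2.2.1 x.2.2.2.2.2) ∧
    ∀ X : RiemCubic.FieldAlong I g,
      letI χ₀ : ℝ → TangentSpace I (1 : G) := fun t ↦ RiemCubic.leftToId I (g t) (X t)
      letI χ₁ := RiemCubic.gDeriv I (Icc a b) ξ₀ χ₀
      letI χ₂ := RiemCubic.gDeriv I (Icc a b) ξ₀ χ₁
      (RiemCubic.SmoothAlong (Icc a b) X → ∀ t ∈ Icc a b,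
        RiemCubic.leftToId I (g t)
            (RiemCubic.bigF (RiemCubic.leviCivita I G) g (Icc a b) X t) =
          RiemCubic.gF I (χ₀ t) (χ₁ t) (χ₂ t) (ξ₀ t) (ξ₁ t) (ξ₂ t)) ∧
      (RiemCubic.IsModifiedBiJacobi I V a b g X ↔
        RiemCubic.IsReducedBiJacobi I Vext a b ξ₀ ξ₁ ξ₂ h χ₀) := by
  have hs : UniqueDiffOn ℝ (Icc a b) := uniqueDiffOn_Icc hab
  have hgs := hg.smooth
  refine ⟨⟨(RiemCubic.gConnL I G).toLinearMap₁₂, fun x y ↦ rfl⟩, ?_, ?_, ?_, ?_⟩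
  · refine ⟨LinearMap.mk₂ ℝ (fun x y ↦ (RiemCubic.gCurvL I G x y).toLinearMap) ?_ ?_ ?_ ?_,
      fun x y z ↦ (hinv.gCurv_eq x y z).symm⟩
    · intro x x' y; ext z; exact RiemCubic.clm₃_add_left _ _ _ _ _
    · intro c x y; ext z; exact RiemCubic.clm₃_smul_left _ _ _ _ _
    · intro x y y'; ext z; exact RiemCubic.clm₂_add_left _ _ _ _
    · intro c x y; ext z; exact RiemCubic.clm₂_smul_left _ _ _ _
  · intro y₀ y₁ y₂
    simp only [hinv.gF_eq]
    exact RiemCubic.isLinearMap_reducedF _ _ y₀ y₁ y₂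
  · simp only [hinv.gF_eq]
    exact RiemCubic.contDiff_reducedF _ _
  · intro X
    have hF : RiemCubic.SmoothAlong (Icc a b) X → ∀ t ∈ Icc a b, _ := fun hX t ht ↦
      hinv.leftToId_bigF hs hgs hξ₀ hξ₁ hξ₂ hX ht
    refine ⟨hF, ?_⟩
    have hcov : ∀ {Y : RiemCubic.FieldAlong I g}, RiemCubic.SmoothAlong (Icc a b) Y →
        RiemCubic.SmoothAlong (Icc a b)
          (RiemCubic.covAlong (RiemCubic.leviCivita I G) (Icc a b) Y) :=
      fun hY ↦ hinv.smoothAlong_covAlong hs hgs hY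
    have hD : ∀ {Y : RiemCubic.FieldAlong I g} {η : ℝ → TangentSpace I (1 : G)},
        RiemCubic.SmoothAlong (Icc a b) Y → EqOn (RiemCubic.leftAlong Y) η (Icc a b) →
        EqOn (RiemCubic.leftAlong (RiemCubic.covAlong (RiemCubic.leviCivita I G) (Icc a b) Y))
          (RiemCubic.gDeriv I (Icc a b) ξ₀ η) (Icc a b) := fun hY hη t ht ↦ by
      rw [hinv.leftToId_covAlong_of_smooth hs hξ₀ hY ht, RiemCubic.gDeriv_congr hη ht]
    have key : ∀ (_ : RiemCubic.SmoothAlong (Icc a b) X) {χ₁ χ₂ χ₃ : ℝ → TangentSpace I (1 : G)},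
        (∀ t ∈ Icc a b, χ₁ t = RiemCubic.gDeriv I (Icc a b) ξ₀ (RiemCubic.leftAlong X) t) →
        (∀ t ∈ Icc a b, χ₂ t = RiemCubic.gDeriv I (Icc a b) ξ₀ χ₁ t) →
        (∀ t ∈ Icc a b, χ₃ t = RiemCubic.gDeriv I (Icc a b) ξ₀ χ₂ t) →
        ∀ t ∈ Icc a b, RiemCubic.leftToId I (g t)
          (RiemCubic.covAlong (RiemCubic.leviCivita I G) (Icc a b)
            (RiemCubic.covAlong (RiemCubic.leviCivita I G) (Icc a b)
            (RiemCubic.covAlong (RiemCubic.leviCivita I G) (Icc a b)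
            (RiemCubic.covAlong (RiemCubic.leviCivita I G) (Icc a b) X))) t
            + RiemCubic.bigF (RiemCubic.leviCivita I G) g (Icc a b) X t
            + RiemCubic.leviCivita I G (RiemCubic.grad I V) (g t) (X t)) =
          RiemCubic.gDeriv I (Icc a b) ξ₀ χ₃ t
            + RiemCubic.gHess I Vext (h t) (RiemCubic.leftAlong X t)
            + RiemCubic.gF I (RiemCubic.leftAlong X t) (χ₁ t) (χ₂ t) (ξ₀ t) (ξ₁ t) (ξ₂ t) := by
      intro hX χ₁ χ₂ χ₃ h₁ h₂ h₃ t ht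
      have d₁ := (hD hX (eqOn_refl _ _)).trans fun τ hτ ↦ (h₁ τ hτ).symm
      have d₂ := (hD (hcov hX) d₁).trans fun τ hτ ↦ (h₂ τ hτ).symm
      have d₃ := (hD (hcov (hcov hX)) d₂).trans fun τ hτ ↦ (h₃ τ hτ).symm
      have d₄ := hD (hcov (hcov (hcov hX))) d₃ ht
      have f₂ : χ₂ t = RiemCubic.gDeriv I (Icc a b) ξ₀
          (RiemCubic.gDeriv I (Icc a b) ξ₀ (RiemCubic.leftAlong X)) t := by
        rw [h₂ t ht, RiemCubic.gDeriv_congr h₁ ht]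
      rw [RiemCubic.leftToId_add, RiemCubic.leftToId_add, hF hX t ht,
        hinv.leftToId_leviCivita_grad hV hVext hVextInv, ← hh t, f₂, h₁ t ht]
      refine Eq.trans ?_ (add_right_comm _ _ _)
      exact congrArg₂ (· + ·) (congrArg₂ (· + ·) d₄ rfl) rfl
    constructor
    · intro hJ
      refine ⟨(hinv.smoothAlong_iff hgs X).1 hJ.smooth, _, _, _, fun _ _ ↦ rfl, fun _ _ ↦ rfl,
        fun _ _ ↦ rfl, fun t ht ↦ ?_⟩
      refine Eq.trans ?_ (key hJ.smooth (fun _ _ ↦ rfl) (fun _ _ ↦ rfl) (fun _ _ ↦ rfl) t ht)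
      rw [hJ.eqn t ht, ← RiemCubic.leftToIdL_apply, map_zero]
    · rintro ⟨hχ, χ₁, χ₂, χ₃, h₁, h₂, h₃, h₄⟩
      have hX := (hinv.smoothAlong_iff hgs X).2 hχ
      refine ⟨hX, fun t ht ↦ RiemCubic.leftToId_injective (g t) ?_⟩
      refine (key hX h₁ h₂ h₃ t ht).trans ((h₄ t ht).symm.trans ?_)
      rw [← RiemCubic.leftToIdL_apply, map_zero]
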